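/- Let $k$ be a field and let $\mathcal B$ be a $k$-linear abelian category such that for all objects $X,Y$ the spaces $\operatorname{Hom}(X,Y)$ and $\operatorname{Ext}^m(X,Y)$, $m\ge 0$, are finite dimensional over $k$ and only finitely many of the $\operatorname{Ext}^m(X,Y)$ are non-zero. Assume that $\mathcal B$ has finite Krull dimension in the sense of Gabriel: with $\mathcal B_{-1}$ the subcategory of zero objects and $\mathcal B_m$ the Serre subcategory of all objects whose image in the quotient category $\mathcal B/\mathcal B_{m-1}$ has finite length, one has $\mathcal B=\mathcal B_m$ for some integer $m\ge -1$. Let $T_1,\dots,T_n$ ($n\ge 0$) be objects of $\mathcal B$ such that * $(T_1,\dots,T_n)$ is an exceptional collection: for every $i$ the ring $\operatorname{End}(T_i)$ is a division ring and $\operatorname{Ext}^m(T_i,T_i)=0$ for all $m>0$, and $\operatorname{Ext}^m(T_i,T_j)=0$ for all $m\ge 0$ whenever $i<j$; * every $T_i$ has projective dimension at most $1$, i.e. $\operatorname{Ext}^m(T_i,-)=0$ for all $m>1$; * $\operatorname{Ext}^1(T_i,T_j)=0$ for all $i,j$. Put $T=\bigoplus_{i=1}^n T_i$. If the rank of the Grothendieck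 group $K_0(\mathcal B)$ of $\mathcal B$ equals $n$, then $T$ is a tilting object in $\mathcal B$: in the bounded derived category $D^b(\mathcal B)$ one has $\operatorname{Hom}(T,T[i])=0$ for all integers $i\neq 0$, and the smallest full subcategory of $D^b(\mathcal B)$ that contains $\operatorname{add} T$ (the direct summands of finite direct sums of copies of $T$) and is closed under isomorphisms, shifts and cones is $D^b(\mathcal B)$ itself. -/

import Mathlib

open CategoryTheory CategoryTheory.Limits

universe w w' v u

attribute [local instance] Abelian.hasFiniteBiproducts

namespace TiltingTheory

section FiniteLength

variable {C : Type u} [Category.{v} C]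

/-- Objects of finite length: both chain conditions hold for subobjects. -/
def finiteLength (C : Type u) [Category.{v} C] : ObjectProperty C :=
  fun X => IsNoetherianObject X ∧ IsArtinianObject X

lemma le_iff_factors {X : C} (S S' : Subobject X) : S ≤ S' ↔ S'.Factors S.arrow := by
  constructor
  · intro h
    exact Subobject.factors_of_le _ h ((Subobject.factors_iff _ _).2 ⟨𝟙 _, Category.id_comp _⟩)
  · intro h
    exact Subobject.le_of_comm (S'.factorThru _ h) (S'.factorThru_arrow _ h)

lemma finiteLength_iff (X : C) :
    finiteLength C X ↔ WellFoundedGT (Subobject X) ∧ WellFoundedLT (Subobject X) := by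
  simp only [finiteLength, IsNoetherianObject, IsArtinianObject, ObjectProperty.is_iff]
  rfl

variable [Abelian C]

lemma factors_iff {X T : C} (S : Subobject X) (t : T ⟶ X) :
    S.Factors t ↔ t ≫ cokernel.π S.arrow = 0 := by
  constructor
  · intro h
    rw [← S.factorThru_arrow t h, Category.assoc, cokernel.condition, comp_zero]
  · intro h
    refine (Subobject.factors_iff _ _).2 ⟨Abelian.monoLift S.arrow t h, ?_⟩
    exact Abelian.monoLift_comp S.arrow t h

lemma factors_of_epi {X T T' : C} (S : Subobject X) (p : T' ⟶ T) [Epi p] (t : T ⟶ X)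
    (h : S.Factors (p ≫ t)) : S.Factors t := by
  rw [factors_iff] at h ⊢
  rw [← cancel_epi p, ← Category.assoc, h, comp_zero]

lemma factors_pullback_iff {X Y T : C} (f : X ⟶ Y) (S : Subobject Y) (t : T ⟶ X) :
    ((Subobject.pullback f).obj S).Factors t ↔ S.Factors (t ≫ f) := by
  have sq := Subobject.isPullback f S
  constructor
  · intro h
    rw [← Subobject.factorThru_arrow _ t h, Category.assoc, ← sq.w, ← Category.assoc]
    exact Subobject.factors_comp_arrow _
  · intro h
    rw [← sq.lift_snd (S.factorThru _ h) t (S.factorThru_arrow _ h)]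
    exact Subobject.factors_comp_arrow _

/-- Inverse images of subobjects along an epimorphism form a strictly increasing map. -/
lemma strictMono_pullback {X Y : C} (p : X ⟶ Y) [Epi p] :
    StrictMono (fun S : Subobject Y => (Subobject.pullback p).obj S) := by
  refine Monotone.strictMono_of_injective (Subobject.pullback p).monotone ?_
  have key : ∀ S S' : Subobject Y,
      (Subobject.pullback p).obj S ≤ (Subobject.pullback p).obj S' → S ≤ S' := by
    intro S S' h
    rw [le_iff_factors]
    refine factors_of_epi S' (pullback.fst S.arrow p) _ ?_
    rw [pullback.condition, ← factors_pullback_iff]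
    refine Subobject.factors_of_le _ h ?_
    rw [factors_pullback_iff, ← pullback.condition]
    exact Subobject.factors_comp_arrow _
  exact fun S S' h => le_antisymm (key S S' (le_of_eq h)) (key S' S (le_of_eq h.symm))

/-- For a short exact sequence `0 ⟶ X₁ ⟶ X₂ ⟶ X₃ ⟶ 0`, a subobject of `X₂` is strictly
increasingly encoded by its inverse image in `X₁` and its image in `X₃`. -/
lemma strictMono_pullback_image {S : ShortComplex C} (hS : S.ShortExact) :
    StrictMono (fun A : Subobject S.X₂ =>
      ((Subobject.pullback S.f).obj A, imageSubobject (A.arrow ≫ S.g))) := by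
  have hmono : Monotone (fun A : Subobject S.X₂ =>
      ((Subobject.pullback S.f).obj A, imageSubobject (A.arrow ≫ S.g))) := by
    intro A B h
    refine ⟨(Subobject.pullback S.f).monotone h, ?_⟩
    dsimp only
    rw [← Subobject.ofLE_arrow h, Category.assoc]
    exact imageSubobject_comp_le _ _
  intro A B hAB
  refine lt_of_le_of_ne (hmono hAB.le) fun heq => hAB.not_ge ?_
  obtain ⟨h₁, h₂⟩ := Prod.ext_iff.1 heq
  dsimp only at h₁ h₂
  have hfac : (imageSubobject (A.arrow ≫ S.g)).Factors (B.arrow ≫ S.g) := by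
    rw [h₂]
    exact (Subobject.factors_iff _ _).2
      ⟨factorThruImageSubobject (B.arrow ≫ S.g), imageSubobject_arrow_comp _⟩
  obtain ⟨T, p, hp, a, ha⟩ := surjective_up_to_refinements_of_epi
    (factorThruImageSubobject (A.arrow ≫ S.g)) ((imageSubobject _).factorThru _ hfac)
  have ha' : p ≫ B.arrow ≫ S.g = a ≫ A.arrow ≫ S.g := by
    have := congrArg (· ≫ (imageSubobject (A.arrow ≫ S.g)).arrow) ha
    simpa using this
  obtain ⟨T', q, hq, x, hx⟩ := hS.exact.exact_up_to_refinements
    (p ≫ B.arrow - a ≫ A.arrow) (by simp [Preadditive.sub_comp, ha'])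
  have hxB : B.Factors (x ≫ S.f) := by
    rw [← hx, ← Subobject.ofLE_arrow hAB.le, ← Category.assoc a, ← Preadditive.sub_comp,
      ← Category.assoc]
    exact Subobject.factors_comp_arrow _
  have hxA : A.Factors (x ≫ S.f) := by
    rw [← factors_pullback_iff] at hxB ⊢
    rwa [h₁]
  rw [le_iff_factors]
  refine factors_of_epi A p _ (factors_of_epi A q _ ?_)
  have : q ≫ p ≫ B.arrow = x ≫ S.f + (q ≫ a) ≫ A.arrow := by
    rw [← hx]; simp [Preadditive.comp_sub]
  rw [this]
  exact Subobject.factors_add _ _ hxA (Subobject.factors_comp_arrow _)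

/-- In an abelian category the objects of finite length form a Serre class. -/
instance isSerreClass_finiteLength : (finiteLength C).IsSerreClass where
  exists_zero := open ZeroObject in ⟨(0 : C), isZero_zero C, isNoetherianObject_of_isZero (isZero_zero C),
    isArtinianObject_of_isZero (isZero_zero C)⟩
  prop_of_mono f _ hY := by
    obtain ⟨_, _⟩ := hY
    exact ⟨isNoetherianObject_of_mono f, isArtinianObject_of_mono f⟩
  prop_of_epi f _ hX := by
    rw [finiteLength_iff] at hX ⊢
    obtain ⟨_, _⟩ := hX
    exact ⟨(strictMono_pullback f).wellFoundedGT, (strictMono_pullback f).wellFoundedLT⟩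
  prop_X₂_of_shortExact hS h₁ h₃ := by
    rw [finiteLength_iff] at h₁ h₃ ⊢
    obtain ⟨_, _⟩ := h₁
    obtain ⟨_, _⟩ := h₃
    exact ⟨(strictMono_pullback_image hS).wellFoundedGT,
      (strictMono_pullback_image hS).wellFoundedLT⟩

end FiniteLength

section KrullDimension

variable {C : Type u} [Category.{v} C] [Abelian C]

/-- For a Serre subcategory `P` of `C`: the objects of `C` whose image in the quotient category
`C / P` has finite length. -/
def finiteLengthModSerre (P : ObjectProperty C) [P.IsSerreClass] : ObjectProperty C :=
  (finiteLength P.isoModSerre.Localization).inverseImage P.isoModSerre.Q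

instance (P : ObjectProperty C) [P.IsSerreClass] : (finiteLengthModSerre P).IsSerreClass := by
  let : Abelian P.isoModSerre.Localization :=
    ObjectProperty.SerreClassLocalization.abelian P.isoModSerre.Q P
  have := ObjectProperty.SerreClassLocalization.preservesFiniteLimits P.isoModSerre.Q P
  have := ObjectProperty.SerreClassLocalization.preservesFiniteColimits P.isoModSerre.Q P
  exact inferInstanceAs ((finiteLength _).inverseImage P.isoModSerre.Q).IsSerreClass

/-- The Krull filtration (Gabriel) of an abelian category by Serre subcategories, with the index
shifted by one: the term of index `0` consists of the zero objects (it is usually written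
`C_{-1}`), and the term of index `n + 1` (usually written `C_n`) consists of the objects which
have finite length in the quotient of `C` by the term of index `n`. -/
def krullFiltrationAux (C : Type u) [Category.{v} C] [Abelian C] :
    ℕ → {P : ObjectProperty C // P.IsSerreClass}
  | 0 => ⟨IsZero, inferInstance⟩
  | n + 1 =>
    haveI := (krullFiltrationAux C n).2
    ⟨finiteLengthModSerre (krullFiltrationAux C n).1, inferInstance⟩

/-- The `n`-th term of the (shifted) Krull filtration, as a property of objects. -/
def krullFiltration (C : Type u) [Category.{v} C] [Abelian C] (n : ℕ) : ObjectProperty C :=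
  (krullFiltrationAux C n).1

/-- An abelian category has finite Krull dimension if its Krull filtration reaches the whole
category after finitely many steps. -/
def HasFiniteKrullDimension (C : Type u) [Category.{v} C] [Abelian C] : Prop :=
  ∃ n : ℕ, ∀ X : C, krullFiltration C n X

end KrullDimension

section GrothendieckGroup

/-- The relations `[X₂] = [X₁] + [X₃]` for all short exact sequences
`0 ⟶ X₁ ⟶ X₂ ⟶ X₃ ⟶ 0`. -/
def K₀Relations (C : Type u) [Category.{v} C] [Abelian C] : AddSubgroup (FreeAbelianGroup C) :=
  AddSubgroup.closure {x | ∃ S : ShortComplex C, S.ShortExact ∧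
    x = FreeAbelianGroup.of S.X₂ - FreeAbelianGroup.of S.X₁ - FreeAbelianGroup.of S.X₃}

/-- The Grothendieck group of an abelian category. -/
abbrev K₀ (C : Type u) [Category.{v} C] [Abelian C] : Type u :=
  FreeAbelianGroup C ⧸ K₀Relations C

end GrothendieckGroup

section Exceptional

variable {C : Type u} [Category.{v} C] [Abelian C] [HasExt.{w} C]

/-- All `Hom`- and `Ext`-spaces are finite dimensional over `k`, and for any two objects only
finitely many `Ext`-spaces between them are non-zero. -/
structure IsExtFinite (k : Type*) [Field k] (C : Type u) [Category.{v} C] [Abelian C]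
    [Linear k C] [HasExt.{w} C] : Prop where
  finite_hom (X Y : C) : Module.Finite k (X ⟶ Y)
  finite_ext (X Y : C) (m : ℕ) : Module.Finite k (Abelian.Ext.{w} X Y m)
  finite_degrees (X Y : C) : {m : ℕ | Nontrivial (Abelian.Ext.{w} X Y m)}.Finite

/-- `X` is exceptional: `Ext^m(X, X) = 0` for `m > 0` and `End X` is a division ring. -/
structure IsExceptional (X : C) : Prop where
  ext_self (m : ℕ) (hm : 0 < m) : Subsingleton (Abelian.Ext.{w} X X m)
  nontrivial_end : Nontrivial (End X)
  isUnit_of_ne_zero (f : End X) (hf : f ≠ 0) : IsUnit f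

/-- `T₁, …, Tₙ` is an exceptional collection: every `Tᵢ` is exceptional and
`Ext^m(Tᵢ, Tⱼ) = 0` for all `m ≥ 0` if `i < j`. -/
structure IsExceptionalCollection {n : ℕ} (T : Fin n → C) : Prop where
  isExceptional (i : Fin n) : IsExceptional.{w} (T i)
  ext_of_lt (i j : Fin n) (hij : i < j) (m : ℕ) : Subsingleton (Abelian.Ext.{w} (T i) (T j) m)

end Exceptional

section Tilting

open Pretriangulated

/-- `add T`: the direct summands of finite direct sums of copies of `T`. -/
def addClosure {A : Type*} [Category* A] [Preadditive A] [HasFiniteBiproducts A] (T : A) :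
    ObjectProperty A :=
  fun X => ∃ m : ℕ, Nonempty (Retract X (⨁ fun _ : Fin m => T))

/-- `T` is a tilting object of the triangulated category `A`: `Hom(T, T[i]) = 0` for all integers
`i ≠ 0`, and `A` is its only full subcategory that contains `add T` and is closed under shifts,
cones and isomorphisms. -/
structure IsTriangulatedTilting {A : Type*} [Category* A] [Preadditive A] [HasZeroObject A]
    [HasShift A ℤ] [∀ n : ℤ, (shiftFunctor A n).Additive] [Pretriangulated A]
    (T : A) : Prop where
  hom_shift_eq_zero (i : ℤ) (hi : i ≠ 0) (f : T ⟶ T⟦i⟧) : f = 0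
  generates (P : ObjectProperty A) (hP : P.IsTriangulated) (hiso : P.IsClosedUnderIsomorphisms)
    (hT : addClosure T ≤ P) (X : A) : P X

variable (C : Type u) [Category.{v} C] [Abelian C] [HasDerivedCategory.{w} C]

/-- The bounded derived category of `C`: the full triangulated subcategory of the derived category
on the objects with bounded cohomology. -/
abbrev BoundedDerivedCategory : Type (max u v) :=
  (DerivedCategory.TStructure.t (C := C)).bounded.FullSubcategory

variable {C}

/-- An object of `C`, as an object of the bounded derived category placed in degree `0`. -/
noncomputable def toBounded (X : C) : BoundedDerivedCategory C :=
  ⟨(DerivedCategory.singleFunctor C 0).obj X, ⟨0, inferInstance⟩, ⟨0, inferInstance⟩⟩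

/-- `T` is a tilting object of the abelian category `C`: it is one in the bounded derived
category of `C`. -/
def IsTiltingObject (T : C) : Prop :=
  IsTriangulatedTilting (toBounded.{w} T)

end Tilting

end TiltingTheory

/-!
Let `U` be the right perpendicular category of the collection, that is, the objects annihilated by
all `Hom(Tᵢ, -)` and `Ext¹(Tᵢ, -)`. If `U` is nonzero, finite Krull dimension provides a nonzero
additive function on `U`: length in a suitable Gabriel quotient. It extends to an additive function
on the whole category which kills every `Tᵢ`. To pass from the perpendicular category of `E = Tᵢ` to
the ambient category, let first `Ext¹(E, Y) = 0`; then a minimal right `add E`-approximation `p` of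
`Y` has perpendicular kernel and cokernel, and the value at `Y` is `f (coker p) - f (ker p)`. An
arbitrary `X` embeds by a universal extension into such a `Y` with cokernel `Eᵐ`, and takes the
value of `Y`. Together with the Euler forms `χ(Tᵢ, -)` this function pairs with the classes of an
object of `U` and of the `Tᵢ` in a triangular way, which makes `n + 1` classes in `K₀` linearly
independent. So `U = 0` if the rank is `n`, and the same two constructions show that every object
is obtained from the `Tᵢ` and `U` by taking third terms of short exact sequences.
-/

namespace TiltingTheory

section Height

open Order

variable {α β : Type*} [PartialOrder α]

lemma height_prodMk_le [PartialOrder β] (a : α) (b : β) :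
    height (a, b) ≤ height a + height b := by
  suffices key : ∀ (n : ℕ) (a : α) (b : β), height a + height b = n → height (a, b) ≤ n by
    rcases eq_or_ne (height a + height b) ⊤ with h | h
    · exact h ▸ le_top
    · lift height a + height b to ℕ using h with n hn
      exact key n a b hn.symm
  intro n
  induction n using Nat.strong_induction_on with
  | _ n ih =>
    intro a b hab
    have ha : height a < ⊤ := (le_self_add.trans hab.le).trans_lt (ENat.natCast_lt_top n)
    have hb : height b < ⊤ := (le_add_self.trans hab.le).trans_lt (ENat.natCast_lt_top n)
    refine height_le_coe_iff.2 fun ⟨c, d⟩ hcd => ?_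
    have hlt : height c + height d < n := by
      rw [← hab]
      rcases Prod.lt_iff.1 hcd with ⟨hc, hd⟩ | ⟨hc, hd⟩
      · have hc' := height_mono hc.le
        exact ENat.add_lt_add_of_lt_of_le (hb.trans_le' (height_mono hd)).ne
          (height_strictMono hc (hc'.trans_lt ha)) (height_mono hd)
      · have hd' := height_mono hd.le
        exact ENat.add_lt_add_of_le_of_lt (ha.trans_le' (height_mono hc)).ne
          (height_mono hc) (height_strictMono hd (hd'.trans_lt hb))
    lift height c + height d to ℕ using hlt.ne_top with m hm
    exact (ih m (by exact_mod_cast hlt) c d hm.symm).trans_lt hlt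

lemma height_add_height_apply_bot_le [OrderBot α] [Preorder β] {h : α → β}
    (hh : StrictMono h) (a : α) : height a + height (h ⊥) ≤ height (h a) := by
  suffices key : ∀ (n : ℕ) (a : α), n ≤ height a → n + height (h ⊥) ≤ height (h a) by
    rcases eq_or_ne (height a) ⊤ with ha | ha
    · rw [eq_top_iff.2 (ha.ge.trans (height_le_height_apply_of_strictMono h hh a))]
      exact le_top
    · lift height a to ℕ using ha with n hn
      exact key n a hn.le
  intro n
  induction n with
  | zero => simpa using fun a => height_mono (hh.monotone bot_le)
  | succ n ih =>
    intro a ha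
    obtain ⟨b, hba, hb⟩ : ∃ b < a, n ≤ height b := by
      by_contra! hlt
      have := ha.trans (height_le_coe_iff.2 hlt)
      norm_cast at this
      omega
    calc ((n + 1 : ℕ) : ℕ∞) + height (h ⊥) = n + height (h ⊥) + 1 := by push_cast; ring
      _ ≤ height (h b) + 1 := by gcongr; exact ih b hb
      _ ≤ height (h a) := height_add_one_le (hh hba)

end Height

section Length

variable {C : Type u} [Category.{v} C]

/-- The length of an object: the supremum of the lengths of chains of subobjects. -/
noncomputable def objLength (X : C) : ℕ∞ := Order.height (⊤ : Subobject X)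

lemma strictMono_map {X Y : C} (f : X ⟶ Y) [Mono f] :
    StrictMono (fun A : Subobject X => (Subobject.map f).obj A) :=
  (Subobject.map f).monotone.strictMono_of_injective (Subobject.map_obj_injective f)

variable [Abelian C]

lemma map_top_le_pullback {S : ShortComplex C} [Mono S.f] (A : Subobject S.X₃) :
    (Subobject.map S.f).obj ⊤ ≤ (Subobject.pullback S.g).obj A := by
  have hfg : (Subobject.mk S.f).arrow ≫ S.g = 0 := by
    rw [← Subobject.underlyingIso_hom_comp_eq_mk, Category.assoc, S.zero, comp_zero]
  rw [Subobject.map_top, le_iff_factors, factors_pullback_iff, hfg]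
  exact Subobject.factors_zero

lemma objLength_le_add {S : ShortComplex C} (hS : S.ShortExact) :
    objLength S.X₂ ≤ objLength S.X₁ + objLength S.X₃ :=
  (Order.height_le_height_apply_of_strictMono _ (strictMono_pullback_image hS) ⊤).trans <|
    (height_prodMk_le _ _).trans <|
      add_le_add (Order.height_mono le_top) (Order.height_mono le_top)

lemma add_objLength_le {S : ShortComplex C} (hS : S.ShortExact) :
    objLength S.X₁ + objLength S.X₃ ≤ objLength S.X₂ := by
  have := hS.mono_f
  have := hS.epi_g
  calc objLength S.X₁ + objLength S.X₃
      ≤ Order.height ((Subobject.map S.f).obj ⊤) + objLength S.X₃ := by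
        gcongr
        exact Order.height_le_height_apply_of_strictMono _ (strictMono_map S.f) ⊤
    _ ≤ Order.height ((Subobject.pullback S.g).obj ⊥) + objLength S.X₃ := by
        gcongr
        exact map_top_le_pullback (S := S) ⊥
    _ = objLength S.X₃ + Order.height ((Subobject.pullback S.g).obj ⊥) := add_comm _ _
    _ ≤ Order.height ((Subobject.pullback S.g).obj ⊤) :=
        height_add_height_apply_bot_le (strictMono_pullback S.g) ⊤
    _ ≤ objLength S.X₂ := Order.height_mono le_top

lemma objLength_eq_add {S : ShortComplex C} (hS : S.ShortExact) :
    objLength S.X₂ = objLength S.X₁ + objLength S.X₃ :=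
  le_antisymm (objLength_le_add hS) (add_objLength_le hS)

lemma objLength_eq_zero_iff {X : C} : objLength X = 0 ↔ IsZero X := by
  rw [objLength, Order.height_eq_zero, isMin_iff_eq_bot]
  constructor
  · intro h
    by_contra hX
    have := Subobject.nontrivial_of_not_isZero hX
    exact top_ne_bot h
  · intro hX
    have := Subobject.subsingleton_of_isZero hX
    exact Subsingleton.elim _ _

lemma objLength_cokernel_ofLE_le_one {X : C} {A B : Subobject X} (h : A ⋖ B) :
    objLength (cokernel (Subobject.ofLE A B h.le)) ≤ 1 := by
  let S := ShortComplex.mk _ _ (cokernel.condition (Subobject.ofLE A B h.le))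
  let φ (D : Subobject S.X₃) : Subobject X :=
    (Subobject.map B.arrow).obj ((Subobject.pullback S.g).obj D)
  have hφ : StrictMono φ := (strictMono_map B.arrow).comp (strictMono_pullback S.g)
  have le_φ (D) : A ≤ φ D := by
    have hA : A = (Subobject.map B.arrow).obj ((Subobject.map S.f).obj ⊤) := by
      rw [Subobject.map_top, Subobject.map_mk]
      simp [S]
    rw [hA]
    exact (Subobject.map B.arrow).monotone (map_top_le_pullback D)
  have φ_le (D) : φ D ≤ B := by
    have hB : B = (Subobject.map B.arrow).obj ⊤ := by
      rw [Subobject.map_top, Subobject.mk_arrow]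
    conv_rhs => rw [hB]
    exact (Subobject.map B.arrow).monotone le_top
  by_contra! hlt
  obtain ⟨D, D', hD', hD⟩ := Order.one_lt_height_iff.1 hlt
  exact h.2 ((le_φ D').trans_lt (hφ hD')) ((hφ hD).trans_le (φ_le _))

lemma objLength_ne_top {X : C} (hX : finiteLength C X) : objLength X ≠ ⊤ := by
  obtain ⟨_, _⟩ := (finiteLength_iff X).1 hX
  obtain ⟨a, ha₀, n, ha, hcov⟩ :=
    exists_covBy_seq_of_wellFoundedLT_wellFoundedGT (Subobject X)
  have key (i : ℕ) (hi : i ≤ n) : objLength (a i : C) ≠ ⊤ := by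
    induction i with
    | zero =>
      have h0 : IsZero (a 0 : C) := by
        rw [isMin_iff_eq_bot.1 ha₀]
        exact (isZero_zero C).of_iso Subobject.botCoeIsoZero
      simp [objLength_eq_zero_iff.2 h0]
    | succ i ih =>
      have hS : (ShortComplex.mk _ _
          (cokernel.condition (Subobject.ofLE _ _ (hcov i hi).le))).ShortExact :=
        { exact := ShortComplex.exact_cokernel _ }
      refine ne_top_of_le_ne_top ?_ (objLength_le_add hS)
      exact WithTop.add_ne_top.2 ⟨ih (by omega),
        ne_top_of_le_ne_top ENat.one_ne_top (objLength_cokernel_ofLE_le_one (hcov i hi))⟩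
  have hn := key n le_rfl
  rw [isMax_iff_eq_top.1 ha] at hn
  let e := Subobject.mapIsoToOrderIso (asIso (⊤ : Subobject X).arrow)
  rwa [objLength, ← Order.height_orderIso e, map_top] at hn

end Length

section Wide

variable {C : Type u} [Category.{v} C] [Abelian C]

/-- A full subcategory is wide if it contains zero and is closed under kernels, cokernels and
extensions. -/
class IsWide (A : ObjectProperty C) : Prop extends A.ContainsZero, A.IsClosedUnderKernels,
  A.IsClosedUnderCokernels, A.IsClosedUnderExtensions

variable {A A' : ObjectProperty C}

instance isClosedUnderIsomorphisms_of_isClosedUnderExtensions [A.ContainsZero]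
    [A.IsClosedUnderExtensions] : A.IsClosedUnderIsomorphisms where
  of_iso {X Y} e hX := by
    obtain ⟨Z, hZ, hAZ⟩ := A.exists_prop_of_containsZero
    have hS : (ShortComplex.mk e.hom (0 : Y ⟶ Z) comp_zero).ShortExact :=
      { exact := (ShortComplex.exact_iff_epi _ rfl).2 (inferInstanceAs (Epi e.hom))
        epi_g := ⟨fun _ _ _ => hZ.eq_of_src _ _⟩ }
    exact A.prop_X₂_of_shortExact hS hX hAZ

lemma isWide_of_kernel_of_cokernel [A.ContainsZero] [A.IsClosedUnderExtensions]
    (hker : ∀ ⦃X Y : C⦄ (f : X ⟶ Y), A X → A Y → A (kernel f))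
    (hcoker : ∀ ⦃X Y : C⦄ (f : X ⟶ Y), A X → A Y → A (cokernel f)) : IsWide A where
  kernels_le := by
    rintro _ ⟨f, k, hk, hX, hY⟩
    exact A.prop_of_iso ((kernelIsKernel f).conePointUniqueUpToIso hk) (hker f hX hY)
  cokernels_le := by
    rintro _ ⟨f, k, hk, hX, hY⟩
    exact A.prop_of_iso ((cokernelIsCokernel f).coconePointUniqueUpToIso hk) (hcoker f hX hY)

instance isWide_top : IsWide (⊤ : ObjectProperty C) :=
  isWide_of_kernel_of_cokernel (fun _ _ _ _ _ => trivial) (fun _ _ _ _ _ => trivial)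

instance isWide_inf [IsWide A] [IsWide A'] : IsWide (A ⊓ A') :=
  have : (A ⊓ A').IsClosedUnderExtensions := ⟨fun hS h₁ h₃ =>
    ⟨A.prop_X₂_of_shortExact hS h₁.1 h₃.1, A'.prop_X₂_of_shortExact hS h₁.2 h₃.2⟩⟩
  isWide_of_kernel_of_cokernel
    (fun _ _ f hX hY => ⟨A.prop_kernel f hX.1 hY.1, A'.prop_kernel f hX.2 hY.2⟩)
    (fun _ _ f hX hY => ⟨A.prop_cokernel f hX.1 hY.1, A'.prop_cokernel f hX.2 hY.2⟩)

end Wide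

section ShortExact

variable {C : Type u} [Category.{v} C] [Abelian C]

lemma shortExact_cokernel {X Y : C} (f : X ⟶ Y) [Mono f] :
    (ShortComplex.mk f (cokernel.π f) (cokernel.condition f)).ShortExact where
  exact := ShortComplex.exact_cokernel f

lemma shortExact_kernel {X Y : C} (f : X ⟶ Y) [Epi f] :
    (ShortComplex.mk (kernel.ι f) f (kernel.condition f)).ShortExact where
  exact := ShortComplex.exact_kernel f

lemma shortExact_image {S : ShortComplex C} (hS : S.Exact) :
    (ShortComplex.mk (Abelian.image.ι S.f) (Abelian.factorThruImage S.g)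
      (by simp [← cancel_mono (Abelian.image.ι S.g),
        Abelian.image_ι_comp_eq_zero S.zero])).ShortExact where
  exact := ShortComplex.exact_of_f_is_kernel _ <|
    isKernelOfComp _ _ hS.isLimitImage _ (Abelian.image.fac S.g)

lemma shortExact_of_isPushout {S : ShortComplex C} (hS : S.ShortExact) {Z P : C}
    {l : S.X₁ ⟶ Z} {r : S.X₂ ⟶ P} {b : Z ⟶ P} (sq : IsPushout S.f l r b) :
    (ShortComplex.mk b (sq.desc S.g 0 (by simp)) (by simp)).ShortExact := by
  have := hS.mono_f
  have := hS.epi_g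
  have : Mono b := Abelian.mono_inr_of_isColimit _ _ sq.isColimit
  have : Epi (sq.desc S.g 0 (by simp)) := epi_of_epi_fac (sq.inl_desc S.g 0 (by simp))
  refine { exact := ShortComplex.exact_of_g_is_cokernel _ (CokernelCofork.IsColimit.ofπ _ _
    (fun g hg => hS.exact.desc (r ≫ g) (by rw [sq.w_assoc, hg, comp_zero])) ?_ ?_) }
  · intro T g hg
    apply sq.hom_ext
    · simp
    · simpa using hg.symm
  · intro T g hg m hm
    rw [← cancel_epi S.g, hS.exact.g_desc, ← hm, sq.inl_desc_assoc]

lemma isPushout_cokernel_comp {S : ShortComplex C} (hS : S.Exact) [Epi S.g] {Y : C}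
    (i : S.X₂ ⟶ Y) :
    IsPushout i S.g (cokernel.π (S.f ≫ i))
      (hS.desc (i ≫ cokernel.π (S.f ≫ i)) (by simp [← Category.assoc])) where
  w := by simp
  isColimit' := ⟨PushoutCocone.IsColimit.mk _
    (fun s => cokernel.desc _ s.inl (by simp [s.condition])) (by simp)
    (fun s => by simp [← cancel_epi S.g, s.condition])
    (fun s m hm _ => by simp [← cancel_epi (cokernel.π (S.f ≫ i)), hm])⟩

end ShortExact

section AdditiveFunctions

variable {C : Type u} [Category.{v} C] [Abelian C] {M : Type*} [AddCommGroup M]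

/-- `f` is additive on the short exact sequences whose terms satisfy `A`. -/
def IsAdditiveOn (A : ObjectProperty C) (f : C → M) : Prop :=
  ∀ ⦃S : ShortComplex C⦄, S.ShortExact → A S.X₁ → A S.X₂ → A S.X₃ → f S.X₂ = f S.X₁ + f S.X₃

namespace IsAdditiveOn

variable {A A' : ObjectProperty C} {f : C → M}

lemma mono (hf : IsAdditiveOn A f) (h : A' ≤ A) : IsAdditiveOn A' f :=
  fun _ hS h₁ h₂ h₃ => hf hS (h _ h₁) (h _ h₂) (h _ h₃)

lemma map_isZero (hf : IsAdditiveOn A f) {X : C} (hX : IsZero X) (hA : A X) : f X = 0 := by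
  have hS : (ShortComplex.mk (𝟙 X) (𝟙 X) (hX.eq_of_src _ _)).ShortExact :=
    { exact := ShortComplex.exact_of_isZero_X₂ _ hX }
  simpa using hf hS hA hA hA

lemma congr_of_iso (hf : IsAdditiveOn A f) [A.ContainsZero] [A.IsClosedUnderIsomorphisms]
    {X Y : C} (e : X ≅ Y) (hX : A X) : f X = f Y := by
  have h0 : IsZero (cokernel e.hom) := isZero_cokernel_of_epi e.hom
  have hc := A.prop_of_isZero h0
  have hY : f Y = f X + f (cokernel e.hom) :=
    hf (shortExact_cokernel e.hom) hX (A.prop_of_iso e hX) hc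
  rw [hY, hf.map_isZero h0 hc, add_zero]

/-- Both sides equal the difference in the pushout of `S.f` and `i`. -/
lemma sub_eq_sub_cokernel (hf : IsAdditiveOn A f) [A.IsClosedUnderExtensions]
    {S : ShortComplex C} (hS : S.ShortExact) (h₂ : A S.X₂) (h₃ : A S.X₃) {Y : C} (i : S.X₁ ⟶ Y)
    [Mono i] (hY : A Y) (hi : A (cokernel i)) : f S.X₂ - f S.X₃ = f Y - f (cokernel i) := by
  have sq := IsPushout.of_hasPushout S.f i
  have hE := shortExact_of_isPushout hS sq
  have hE' := shortExact_of_isPushout (shortExact_cokernel i) sq.flip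
  have hP : A (pushout S.f i) := A.prop_X₂_of_shortExact hE hY h₃
  have h : f Y + f S.X₃ = f S.X₂ + f (cokernel i) :=
    (hf hE hY hP h₃).symm.trans (hf hE' h₂ hP hi)
  rw [sub_eq_sub_iff_add_eq_add, ← h]

end IsAdditiveOn

/-- The extension is `g X = f Y - f (Y / X)` for any embedding of `X` into an object `Y` of `V`. -/
lemma exists_isAdditiveOn_of_coresolution {A V : ObjectProperty C} [A.IsClosedUnderCokernels]
    [V.ContainsZero] [V.IsClosedUnderExtensions] (hVA : V ≤ A)
    (hV : ∀ ⦃X Y : C⦄ (p : X ⟶ Y) [Epi p], V X → A Y → V Y)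
    (hres : ∀ X, A X → ∃ (Y : C) (i : X ⟶ Y), Mono i ∧ V Y)
    {f : C → M} (hf : IsAdditiveOn V f) :
    ∃ g : C → M, IsAdditiveOn A g ∧ ∀ X, V X → g X = f X := by
  classical
  choose Y i hi hY using hres
  have hV_coker {X Y : C} (j : X ⟶ Y) (hX : A X) (hY : V Y) : V (cokernel j) :=
    hV (cokernel.π j) hY (A.prop_cokernel j hX (hVA _ hY))
  let g (X : C) : M := if hX : A X then f (Y X hX) - f (cokernel (i X hX)) else 0
  have hg {S : ShortComplex C} (hS : S.ShortExact) (h₁ : A S.X₁) (h₂ : V S.X₂) (h₃ : V S.X₃) :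
      g S.X₁ = f S.X₂ - f S.X₃ := by
    have := hi _ h₁
    simp only [g, dif_pos h₁]
    exact (hf.sub_eq_sub_cokernel hS h₂ h₃ (i _ h₁) (hY _ h₁) (hV_coker _ h₁ (hY _ h₁))).symm
  refine ⟨g, fun S hS h₁ h₂ h₃ => ?_, fun X hX => ?_⟩
  · have := hS.mono_f
    have := hS.epi_g
    have := hi _ h₂
    have hY₂ := hY _ h₂
    have hC₁ := hV_coker (S.f ≫ i _ h₂) h₁ hY₂
    have hC₂ := hV_coker (i _ h₂) h₂ hY₂
    have hg₁ := hg (shortExact_cokernel (S.f ≫ i _ h₂)) h₁ hY₂ hC₁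
    have hg₂ := hg (shortExact_cokernel (i _ h₂)) h₂ hY₂ hC₂
    have hg₃ := hg (shortExact_of_isPushout (shortExact_cokernel (i _ h₂))
      (isPushout_cokernel_comp hS.exact (i _ h₂))) h₃ hC₁ hC₂
    dsimp only at hg₁ hg₂ hg₃
    rw [hg₁, hg₂, hg₃]
    abel
  · have h0 : IsZero (cokernel (𝟙 X)) := isZero_cokernel_of_epi _
    have hgX := hg (shortExact_cokernel (𝟙 X)) (hVA _ hX) hX (V.prop_of_isZero h0)
    rwa [hf.map_isZero h0 (V.prop_of_isZero h0), sub_zero] at hgX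

end AdditiveFunctions

section Perpendicular

open Abelian

variable {C : Type u} [Category.{v} C] [Abelian C] [HasExt.{w} C]

/-- The objects `X` with `Ext¹(E, X) = 0`. -/
def extOneVanish (E : C) : ObjectProperty C := fun X => Subsingleton (Ext.{w} E X 1)

/-- The right perpendicular category of `E`, defined by the vanishing of `Hom(E, -)` and
`Ext¹(E, -)`. It is used for `E` of projective dimension at most one only, where the higher
`Ext^m(E, -)` vanish anyway. -/
def perp (E : C) : ObjectProperty C := fun X => (∀ f : E ⟶ X, f = 0) ∧ extOneVanish.{w} E X

variable {E : C}

instance containsZero_extOneVanish : (extOneVanish.{w} E).ContainsZero where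
  exists_zero := ⟨_, isZero_zero C, ⟨fun a b => by
    rw [← a.comp_mk₀_id, ← b.comp_mk₀_id, (isZero_zero C).eq_of_src (𝟙 _) 0, Ext.mk₀_zero,
      Ext.comp_zero, Ext.comp_zero]⟩⟩

instance isClosedUnderExtensions_extOneVanish :
    (extOneVanish.{w} E).IsClosedUnderExtensions where
  prop_X₂_of_shortExact {S} hS h₁ h₃ := by
    have : Subsingleton (Ext.{w} E S.X₁ 1) := h₁
    have : Subsingleton (Ext.{w} E S.X₃ 1) := h₃
    refine subsingleton_of_forall_eq 0 fun x => ?_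
    obtain ⟨y, rfl⟩ := Ext.covariant_sequence_exact₂ E hS x (Subsingleton.elim _ _)
    rw [Subsingleton.elim y 0, Ext.zero_comp]

lemma exists_lift_of_extOneVanish {S : ShortComplex C} (hS : S.ShortExact)
    (h : extOneVanish.{w} E S.X₁) (g : E ⟶ S.X₃) : ∃ g' : E ⟶ S.X₂, g' ≫ S.g = g := by
  have : Subsingleton (Ext.{w} E S.X₁ 1) := h
  obtain ⟨x, hx⟩ := Ext.covariant_sequence_exact₃ E hS (Ext.mk₀ g) (zero_add 1)
    (Subsingleton.elim _ _)
  obtain ⟨g', rfl⟩ := (Ext.mk₀_bijective _ _).2 x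
  refine ⟨g', (Ext.mk₀_bijective _ _).1 ?_⟩
  rw [← hx, Ext.mk₀_comp_mk₀]

lemma extOneVanish_of_exists_lift {S : ShortComplex C} (hS : S.ShortExact)
    (h₂ : extOneVanish.{w} E S.X₂) (h : ∀ g : E ⟶ S.X₃, ∃ g' : E ⟶ S.X₂, g' ≫ S.g = g) :
    extOneVanish.{w} E S.X₁ := by
  have : Subsingleton (Ext.{w} E S.X₂ 1) := h₂
  refine subsingleton_of_forall_eq 0 fun x => ?_
  obtain ⟨y, rfl⟩ := Ext.covariant_sequence_exact₁ E hS x (Subsingleton.elim _ _) (zero_add 1)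
  obtain ⟨g, rfl⟩ := (Ext.mk₀_bijective _ _).2 y
  obtain ⟨g', rfl⟩ := h g
  rw [← Ext.mk₀_comp_mk₀, Ext.comp_assoc_of_second_deg_zero, hS.comp_extClass, Ext.comp_zero]

lemma exists_ext_lift [HasProjectiveDimensionLE E 1] {S : ShortComplex C} (hS : S.ShortExact)
    (x : Ext.{w} E S.X₃ 1) : ∃ y : Ext.{w} E S.X₂ 1, y.comp (Ext.mk₀ S.g) (add_zero 1) = x :=
  Ext.covariant_sequence_exact₃ E hS x (n₁ := 2) rfl
    (Ext.eq_zero_of_hasProjectiveDimensionLT _ 2 le_rfl)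

instance isClosedUnderQuotients_extOneVanish [HasProjectiveDimensionLE E 1] :
    (extOneVanish.{w} E).IsClosedUnderQuotients where
  prop_of_epi {X Y} p _ hX := by
    have : Subsingleton (Ext.{w} E X 1) := hX
    refine subsingleton_of_forall_eq 0 fun x => ?_
    obtain ⟨y, rfl⟩ := exists_ext_lift (shortExact_kernel p) x
    rw [Subsingleton.elim y 0, Ext.zero_comp]

instance isWide_perp [HasProjectiveDimensionLE E 1] : IsWide (perp.{w} E) := by
  have : (perp.{w} E).ContainsZero :=
    ⟨_, isZero_zero C, fun _ => (isZero_zero C).eq_of_tgt _ _, (extOneVanish E).prop_zero⟩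
  have : (perp.{w} E).IsClosedUnderExtensions := ⟨fun {S} hS h₁ h₃ => by
    have := hS.mono_f
    refine ⟨fun f => ?_, (extOneVanish E).prop_X₂_of_shortExact hS h₁.2 h₃.2⟩
    rw [← hS.exact.lift_f f (h₃.1 _), h₁.1 (hS.exact.lift f _), zero_comp]⟩
  refine isWide_of_kernel_of_cokernel (fun X Y f hX hY => ⟨fun g => ?_, ?_⟩)
    (fun X Y f hX hY => ⟨fun g => ?_, ?_⟩)
  · rw [← cancel_mono (kernel.ι f), hX.1 (g ≫ kernel.ι f), zero_comp]
  · refine extOneVanish_of_exists_lift (shortExact_cokernel (kernel.ι f)) hX.2 fun g => ⟨0, ?_⟩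
    rw [← cancel_mono (Abelian.factorThruCoimage f), hY.1 (g ≫ _), zero_comp, zero_comp]
  · obtain ⟨g', rfl⟩ := exists_lift_of_extOneVanish (shortExact_kernel (cokernel.π f))
      ((extOneVanish E).prop_of_epi (Abelian.factorThruImage f) hX.2) g
    rw [hY.1 g', zero_comp]
  · exact (extOneVanish E).prop_of_epi (cokernel.π f) hY.2

end Perpendicular

section Approximation

variable {C : Type u} [Category.{v} C] [Abelian C]

/-- Finite direct sums of copies of `E`. -/
inductive IsFiniteSum (E : C) : C → Prop
  | zero {X : C} (hX : IsZero X) : IsFiniteSum E X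
  | self : IsFiniteSum E E
  | biprod {X Y : C} (hX : IsFiniteSum E X) (hY : IsFiniteSum E Y) : IsFiniteSum E (X ⊞ Y)

variable {E : C}

namespace IsFiniteSum

variable {P : C} (hP : IsFiniteSum E P)
include hP

lemma prop {A : ObjectProperty C} [A.ContainsZero] [A.IsClosedUnderExtensions] (hE : A E) :
    A P := by
  induction hP with
  | zero hX => exact A.prop_of_isZero hX
  | self => exact hE
  | biprod _ _ h h' => exact A.prop_biprod h h'

variable {X Y : C} {p : X ⟶ Y}

lemma exists_lift (h : ∀ g : E ⟶ Y, ∃ g' : E ⟶ X, g' ≫ p = g) (g : P ⟶ Y) :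
    ∃ g' : P ⟶ X, g' ≫ p = g := by
  induction hP with
  | zero hX => exact ⟨0, hX.eq_of_src _ _⟩
  | self => exact h g
  | biprod _ _ h h' =>
    obtain ⟨a, ha⟩ := h (biprod.inl ≫ g)
    obtain ⟨b, hb⟩ := h' (biprod.inr ≫ g)
    exact ⟨biprod.desc a b, by ext <;> simp [ha, hb]⟩

lemma eq_zero_of_comp_eq_zero (h : ∀ g : E ⟶ X, g ≫ p = 0 → g = 0) (g : P ⟶ X)
    (hg : g ≫ p = 0) : g = 0 := by
  induction hP with
  | zero hX => exact hX.eq_of_src _ _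
  | self => exact h g hg
  | biprod _ _ h h' =>
    ext
    · simpa using h (biprod.inl ≫ g) (by simp [hg])
    · simpa using h' (biprod.inr ≫ g) (by simp [hg])

end IsFiniteSum

/-- A minimal right `add E`-approximation `p : P ⟶ X`: composition with `p` is a bijection
`Hom(E, P) → Hom(E, X)`. -/
structure IsApprox (E : C) {P X : C} (p : P ⟶ X) : Prop where
  isFiniteSum : IsFiniteSum E P
  eq_zero (g : E ⟶ P) (hg : g ≫ p = 0) : g = 0
  exists_lift (g : E ⟶ X) : ∃ g' : E ⟶ P, g' ≫ p = g

lemma eq_zero_of_comp_desc_eq_zero (hdiv : ∀ f : End E, f ≠ 0 → IsUnit f) {P X : C} {p : P ⟶ X}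
    (hp : ∀ g : E ⟶ P, g ≫ p = 0 → g = 0) {f : E ⟶ X} (hf : ∀ g : E ⟶ P, g ≫ p ≠ f)
    (g : E ⟶ P ⊞ E) (hg : g ≫ biprod.desc p f = 0) : g = 0 := by
  have hsum : (g ≫ biprod.fst) ≫ p + (g ≫ biprod.snd) ≫ f = 0 := by
    rw [← hg, biprod.desc_eq, Preadditive.comp_add, Category.assoc, Category.assoc]
  have hsnd : g ≫ biprod.snd = 0 := by
    by_contra hne
    have : IsIso (g ≫ biprod.snd) := (isUnit_iff_isIso _).1 (hdiv _ hne)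
    refine hf (-(inv (g ≫ biprod.snd) ≫ g ≫ biprod.fst)) ?_
    rw [Preadditive.neg_comp, Category.assoc, eq_neg_of_add_eq_zero_left hsum,
      Preadditive.comp_neg, neg_neg, IsIso.inv_hom_id_assoc]
  rw [hsnd, zero_comp, add_zero] at hsum
  exact biprod.hom_ext _ _ (by rw [hp _ hsum, zero_comp]) (by rw [hsnd, zero_comp])

variable (k : Type*) [Field k] [Linear k C]

lemma finrank_hom_le_of_injective {P X : C} [Module.Finite k (E ⟶ X)] {p : P ⟶ X}
    (hp : ∀ g : E ⟶ P, g ≫ p = 0 → g = 0) :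
    Module.finrank k (E ⟶ P) ≤ Module.finrank k (E ⟶ X) :=
  LinearMap.finrank_le_finrank_of_injective (f := Linear.rightComp k E p)
    ((injective_iff_map_eq_zero _).2 hp)

lemma finrank_hom_lt_finrank_hom_biprod (hE : ¬ IsZero E) (P : C) [Module.Finite k (E ⟶ P ⊞ E)] :
    Module.finrank k (E ⟶ P) < Module.finrank k (E ⟶ P ⊞ E) := by
  let φ := Linear.rightComp k E (biprod.inl : P ⟶ P ⊞ E)
  have hφ : Function.Injective φ := fun g g' h => (cancel_mono (biprod.inl : P ⟶ P ⊞ E)).1 h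
  rw [← LinearMap.finrank_range_of_inj hφ]
  refine Submodule.finrank_lt fun htop => hE ?_
  obtain ⟨x, hx⟩ := LinearMap.range_eq_top.1 htop biprod.inr
  have hx' : x ≫ biprod.inl = (biprod.inr : E ⟶ P ⊞ E) := hx
  rw [IsZero.iff_id_eq_zero, ← biprod.inr_snd (X := P), ← hx', Category.assoc, biprod.inl_snd,
    comp_zero]

lemma exists_isApprox [∀ X : C, Module.Finite k (E ⟶ X)] (hE : ¬ IsZero E)
    (hdiv : ∀ f : End E, f ≠ 0 → IsUnit f) (X : C) : ∃ (P : C) (p : P ⟶ X), IsApprox E p := by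
  let s : Set ℕ := {n | ∃ (P : C) (p : P ⟶ X), IsFiniteSum E P ∧
    (∀ g : E ⟶ P, g ≫ p = 0 → g = 0) ∧ Module.finrank k (E ⟶ P) = n}
  have hs : s.Nonempty := by
    open ZeroObject in
    exact ⟨_, (0 : C), 0, .zero (isZero_zero C), fun g _ => (isZero_zero C).eq_of_tgt _ _, rfl⟩
  have hbdd : BddAbove s := by
    refine ⟨Module.finrank k (E ⟶ X), ?_⟩
    rintro _ ⟨P, p, -, hp, rfl⟩
    exact finrank_hom_le_of_injective k hp
  obtain ⟨P, p, hP, hp, hmax⟩ := Nat.sSup_mem hs hbdd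
  refine ⟨P, p, hP, hp, fun f => ?_⟩
  by_contra! hf
  have hmem : Module.finrank k (E ⟶ P ⊞ E) ∈ s :=
    ⟨P ⊞ E, biprod.desc p f, hP.biprod .self, eq_zero_of_comp_desc_eq_zero hdiv hp hf, rfl⟩
  have hlt := finrank_hom_lt_finrank_hom_biprod k hE P
  exact (hlt.trans_le (le_csSup hbdd hmem)).ne hmax

end Approximation

section ExtensionOfClass

open Abelian Pretriangulated DerivedCategory

variable {C : Type u} [Category.{v} C] [Abelian C]

lemma singleFunctor_hom_shift_eq_zero [HasDerivedCategory.{w'} C] ⦃X Y : C⦄ ⦃n : ℤ⦄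
    (f : (singleFunctor C 0).obj X ⟶ ((singleFunctor C 0).obj Y)⟦n⟧) (hn : n < 0) : f = 0 := by
  have : (((singleFunctor C 0).obj Y)⟦n⟧).IsGE (-n) :=
    TStructure.t.isGE_shift _ 0 n (-n)
  exact TStructure.t.zero f 0 (-n)

lemma shortExact_of_singleFunctor_distinguished [HasDerivedCategory.{w'} C] {X Y Z : C}
    (i : X ⟶ Y) (p : Y ⟶ Z)
    (e : (singleFunctor C 0).obj Z ⟶ ((singleFunctor C 0).obj X)⟦(1 : ℤ)⟧)
    (hT : Triangle.mk ((singleFunctor C 0).map i) ((singleFunctor C 0).map p) e ∈ distTriang _) :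
    ∃ w : i ≫ p = 0, (ShortComplex.mk i p w).ShortExact := by
  have hi := Triangulated.AbelianSubcategory.isLimitKernelForkOfDistTriang
    singleFunctor_hom_shift_eq_zero i p e hT
  have hp := Triangulated.AbelianSubcategory.isColimitCokernelCoforkOfDistTriang
    singleFunctor_hom_shift_eq_zero i p e hT
  have w : (singleFunctor C 0).map i ≫ (singleFunctor C 0).map p = 0 :=
    comp_distTriang_mor_zero₁₂ _ hT
  exact ⟨(singleFunctor C 0).map_injective (by rw [Functor.map_comp, w, Functor.map_zero]),
    { exact := ShortComplex.exact_of_f_is_kernel _ hi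
      mono_f := mono_of_isLimit_fork hi
      epi_g := epi_of_isColimit_cofork hp }⟩

lemma exists_shortExact_of_hom [HasDerivedCategory.{w'} C] {X Z : C}
    (e : (singleFunctor C 0).obj Z ⟶ ((singleFunctor C 0).obj X)⟦(1 : ℤ)⟧) :
    ∃ (Y : C) (i : X ⟶ Y) (p : Y ⟶ Z) (w : i ≫ p = 0), (ShortComplex.mk i p w).ShortExact ∧
      e ≫ ((singleFunctor C 0).map i)⟦(1 : ℤ)⟧' = 0 := by
  obtain ⟨Y', f, g, hT⟩ := distinguished_cocone_triangle₂ e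
  have : Y'.IsGE 0 := TStructure.t.isGE₂ _ hT 0
    (inferInstanceAs (((singleFunctor C 0).obj X).IsGE 0))
    (inferInstanceAs (((singleFunctor C 0).obj Z).IsGE 0))
  have : Y'.IsLE 0 := TStructure.t.isLE₂ _ hT 0
    (inferInstanceAs (((singleFunctor C 0).obj X).IsLE 0))
    (inferInstanceAs (((singleFunctor C 0).obj Z).IsLE 0))
  obtain ⟨Y, ⟨φ⟩⟩ := exists_iso_singleFunctor_obj_of_isGE_of_isLE Y' 0
  obtain ⟨i, hi⟩ := (singleFunctor C 0).map_surjective (f ≫ φ.hom)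
  obtain ⟨p, hp⟩ := (singleFunctor C 0).map_surjective (φ.inv ≫ g)
  have hT' : Triangle.mk ((singleFunctor C 0).map i) ((singleFunctor C 0).map p) e ∈
      distTriang _ :=
    isomorphic_distinguished _ hT _ (Triangle.isoMk _ _ (Iso.refl _) φ.symm (Iso.refl _)
      (show (singleFunctor C 0).map i ≫ φ.inv = 𝟙 _ ≫ f by simp [hi])
      (show (singleFunctor C 0).map p ≫ 𝟙 _ = φ.inv ≫ g by simp [hp])
      (show e ≫ (shiftFunctor _ (1 : ℤ)).map (𝟙 _) = 𝟙 _ ≫ e by simp))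
  obtain ⟨w, hS⟩ := shortExact_of_singleFunctor_distinguished i p e hT'
  exact ⟨Y, i, p, w, hS, comp_distTriang_mor_zero₃₁ _ hT'⟩

lemma exists_shortExact_of_ext [HasExt.{w} C] {X Z : C} (e : Ext.{w} Z X 1) :
    ∃ (Y : C) (i : X ⟶ Y) (p : Y ⟶ Z) (w : i ≫ p = 0), (ShortComplex.mk i p w).ShortExact ∧
      e.comp (Ext.mk₀ i) (add_zero 1) = 0 := by
  let := HasDerivedCategory.standard C
  obtain ⟨Y, i, p, w, hS, he⟩ := exists_shortExact_of_hom e.hom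
  refine ⟨Y, i, p, w, hS, ?_⟩
  ext
  rw [Ext.comp_hom, Ext.mk₀_hom, ShiftedHom.comp_mk₀, Ext.zero_hom]
  exact he

end ExtensionOfClass

section UniversalExtension

open Abelian

variable {C : Type u} [Category.{v} C] [Abelian C] [HasExt.{w} C]
  (k : Type*) [Field k] [Linear k C] {E : C} (hE : extOneVanish.{w} E E)
include hE

lemma finrank_ext_one_lt_of_shortExact {X Y : C} {i : X ⟶ Y} {p : Y ⟶ E} {w : i ≫ p = 0}
    (hS : (ShortComplex.mk i p w).ShortExact) [Module.Finite k (Ext.{w} E X 1)]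
    {e : Ext.{w} E X 1} (he : e ≠ 0) (he' : e.comp (Ext.mk₀ i) (add_zero 1) = 0) :
    Module.finrank k (Ext.{w} E Y 1) < Module.finrank k (Ext.{w} E X 1) := by
  let φ : Ext.{w} E X 1 →ₗ[k] Ext.{w} E Y 1 :=
    (Ext.bilinearCompOfLinear k E X Y 1 0 1 (add_zero 1)).flip (Ext.mk₀ i)
  have : Subsingleton (Ext.{w} E E 1) := hE
  have hφ : Function.Surjective φ := fun x =>
    Ext.covariant_sequence_exact₂ E hS x (Subsingleton.elim _ _)
  have : Nontrivial φ.ker := ⟨⟨e, he'⟩, 0, fun h => he (congrArg Subtype.val h)⟩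
  rw [← φ.finrank_range_add_finrank_ker, LinearMap.range_eq_top.2 hφ, finrank_top]
  exact Nat.lt_add_of_pos_right Module.finrank_pos

/-- Each step kills a nonzero class of `Ext¹(E, X)` by passing to the extension of `E` by `X` it
defines; as `Ext¹(E, E) = 0`, the dimension of `Ext¹(E, X)` drops. -/
lemma exists_universal_extension [∀ X : C, Module.Finite k (Ext.{w} E X 1)]
    {W : ObjectProperty C} [W.ContainsZero] [W.IsClosedUnderExtensions] (hWE : W E) (X : C) :
    ∃ (Y : C) (i : X ⟶ Y), Mono i ∧ extOneVanish.{w} E Y ∧ W (cokernel i) := by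
  induction h : Module.finrank k (Ext.{w} E X 1) using Nat.strong_induction_on generalizing X with
  | _ n ih =>
  subst h
  by_cases hX : extOneVanish.{w} E X
  · exact ⟨X, 𝟙 X, inferInstance, hX, W.prop_of_isZero (isZero_cokernel_of_epi _)⟩
  obtain ⟨e, he⟩ : ∃ e : Ext.{w} E X 1, e ≠ 0 := by
    by_contra! h
    exact hX (subsingleton_of_forall_eq 0 h)
  obtain ⟨X', i, p, w, hS, hi⟩ := exists_shortExact_of_ext e
  have : Mono i := hS.mono_f
  have := hS.epi_g
  obtain ⟨Y, j, hj, hY, hW⟩ := ih _ (finrank_ext_one_lt_of_shortExact k hE hS he hi) X' rfl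
  have hS' := shortExact_of_isPushout (shortExact_cokernel j) (isPushout_cokernel_comp hS.exact j)
  exact ⟨Y, i ≫ j, mono_comp i j, hY, W.prop_X₂_of_shortExact hS' hWE hW⟩

end UniversalExtension

section FredholmIndex

variable {C : Type u} [Category.{v} C] [Abelian C] {M : Type*} [AddCommGroup M]

/-- A morphism is Fredholm relative to `U` if its kernel and its cokernel lie in `U`. -/
structure IsFredholm (U : ObjectProperty C) {X Y : C} (p : X ⟶ Y) : Prop where
  kernel : U (kernel p)
  cokernel : U (cokernel p)

/-- The index of a morphism with respect to `f`. The sign makes the index of `0 ⟶ X` equal to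
`f X`. -/
noncomputable def fredholmIndex (f : C → M) {X Y : C} (p : X ⟶ Y) : M :=
  f (cokernel p) - f (kernel p)

namespace IsAdditiveOn

variable {U : ObjectProperty C} [IsWide U] {f : C → M} (hf : IsAdditiveOn U f)
include hf

lemma fredholmIndex_eq {X Y K Q : C} {p : X ⟶ Y} (hp : IsFredholm U p) {i : K ⟶ X} {q : Y ⟶ Q}
    {wi : i ≫ p = 0} {wq : p ≫ q = 0} (hi : IsLimit (KernelFork.ofι i wi))
    (hq : IsColimit (CokernelCofork.ofπ q wq)) : U K ∧ U Q ∧ fredholmIndex f p = f Q - f K := by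
  have eK : kernel p ≅ K := (kernelIsKernel p).conePointUniqueUpToIso hi
  have eQ : cokernel p ≅ Q := (cokernelIsCokernel p).coconePointUniqueUpToIso hq
  refine ⟨U.prop_of_iso eK hp.kernel, U.prop_of_iso eQ hp.cokernel, ?_⟩
  rw [fredholmIndex, hf.congr_of_iso eK hp.kernel, hf.congr_of_iso eQ hp.cokernel]

lemma fredholmIndex_congr {X X' Y : C} {p : X ⟶ Y} {p' : X' ⟶ Y} (e : X ≅ X')
    (he : e.hom ≫ p' = p) (hp : IsFredholm U p) : fredholmIndex f p = fredholmIndex f p' := by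
  have eK : kernel p ≅ kernel p' := kernel.mapIso p p' e (Iso.refl Y) (by simp [he])
  have eQ : cokernel p ≅ cokernel p' := cokernel.mapIso p p' e (Iso.refl Y) (by simp [he])
  rw [fredholmIndex, fredholmIndex, hf.congr_of_iso eK hp.kernel, hf.congr_of_iso eQ hp.cokernel]

lemma eq_add_image {S : ShortComplex C} (hS : S.Exact) (h₁ : U S.X₁) (h₂ : U S.X₂)
    (h₃ : U S.X₃) : f S.X₂ = f (Abelian.image S.f) + f (Abelian.image S.g) := by
  have h_image {X Y : C} (p : X ⟶ Y) (hX : U X) (hY : U Y) : U (Abelian.image p) :=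
    U.prop_kernel _ hY (U.prop_cokernel _ hX hY)
  exact hf (shortExact_image hS) (h_image S.f h₁ h₂) h₂ (h_image S.g h₂ h₃)

lemma sub_eq_of_snakeInput (D : ShortComplex.SnakeInput C) [Mono D.L₁.f] [Epi D.L₂.g]
    (h₁ : U D.L₀.X₁) (h₂ : U D.L₀.X₂) (h₃ : U D.L₀.X₃)
    (h₁' : U D.L₃.X₁) (h₂' : U D.L₃.X₂) (h₃' : U D.L₃.X₃) :
    f D.L₃.X₂ - f D.L₀.X₂ = (f D.L₃.X₁ - f D.L₀.X₁) + (f D.L₃.X₃ - f D.L₀.X₃) := by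
  have e₁ : f D.L₀.X₂ = f (Abelian.image D.L₀.f) + f (Abelian.image D.L₀.g) :=
    hf.eq_add_image D.L₀_exact h₁ h₂ h₃
  have e₂ : f D.L₀.X₃ = f (Abelian.image D.L₀.g) + f (Abelian.image D.δ) :=
    hf.eq_add_image D.L₁'_exact h₂ h₃ h₁'
  have e₃ : f D.L₃.X₁ = f (Abelian.image D.δ) + f (Abelian.image D.L₃.f) :=
    hf.eq_add_image D.L₂'_exact h₃ h₁' h₂'
  have e₄ : f D.L₃.X₂ = f (Abelian.image D.L₃.f) + f (Abelian.image D.L₃.g) :=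
    hf.eq_add_image D.L₃_exact h₁' h₂' h₃'
  have e₀ : f D.L₀.X₁ = f (Abelian.image D.L₀.f) :=
    hf.congr_of_iso (asIso (Abelian.factorThruImage D.L₀.f)) h₁
  have e₅ : f D.L₃.X₃ = f (Abelian.image D.L₃.g) :=
    hf.congr_of_iso (asIso (Abelian.image.ι D.L₃.g)).symm h₃'
  rw [e₀, e₁, e₂, e₃, e₄, e₅]
  abel

lemma fredholmIndex_add {S S' : ShortComplex C} (hS : S.ShortExact) (hS' : S'.ShortExact)
    (φ : S ⟶ S') (h₁ : IsFredholm U φ.τ₁) (h₂ : IsFredholm U φ.τ₂) (h₃ : IsFredholm U φ.τ₃) :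
    fredholmIndex f φ.τ₂ = fredholmIndex f φ.τ₁ + fredholmIndex f φ.τ₃ := by
  let D : ShortComplex.SnakeInput C :=
    { L₀ := Limits.kernel φ
      L₁ := S
      L₂ := S'
      L₃ := Limits.cokernel φ
      v₀₁ := kernel.ι φ
      v₁₂ := φ
      v₂₃ := cokernel.π φ
      w₀₂ := kernel.condition φ
      w₁₃ := cokernel.condition φ
      h₀ := kernelIsKernel φ
      h₃ := cokernelIsCokernel φ
      L₁_exact := hS.exact
      epi_L₁_g := hS.epi_g
      L₂_exact := hS'.exact
      mono_L₂_f := hS'.mono_f }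
  have : Mono D.L₁.f := hS.mono_f
  have : Epi D.L₂.g := hS'.epi_g
  obtain ⟨k₁, c₁, e₁⟩ := hf.fredholmIndex_eq h₁ D.h₀τ₁ D.h₃τ₁
  obtain ⟨k₂, c₂, e₂⟩ := hf.fredholmIndex_eq h₂ D.h₀τ₂ D.h₃τ₂
  obtain ⟨k₃, c₃, e₃⟩ := hf.fredholmIndex_eq h₃ D.h₀τ₃ D.h₃τ₃
  rw [e₁, e₂, e₃]
  exact hf.sub_eq_of_snakeInput D k₁ k₂ k₃ c₁ c₂ c₃

end IsAdditiveOn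

end FredholmIndex

section PerpendicularExtension

open Abelian

variable {C : Type u} [Category.{v} C] [Abelian C] {E : C}

namespace IsApprox

lemma of_eq_zero {X : C} (hX : ∀ f : E ⟶ X, f = 0) {Z : C} (hZ : IsZero Z) :
    IsApprox E (0 : Z ⟶ X) where
  isFiniteSum := .zero hZ
  eq_zero _ _ := hZ.eq_of_tgt _ _
  exists_lift g := ⟨0, by rw [hX g, comp_zero]⟩

lemma self : IsApprox E (𝟙 E) where
  isFiniteSum := .self
  eq_zero g hg := by simpa using hg
  exists_lift g := ⟨g, Category.comp_id g⟩

lemma exists_iso {P P' X : C} {p : P ⟶ X} {p' : P' ⟶ X} (h : IsApprox E p)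
    (h' : IsApprox E p') : ∃ e : P ≅ P', e.hom ≫ p' = p := by
  obtain ⟨a, ha⟩ := h.isFiniteSum.exists_lift h'.exists_lift p
  obtain ⟨b, hb⟩ := h'.isFiniteSum.exists_lift h.exists_lift p'
  refine ⟨⟨a, b, ?_, ?_⟩, ha⟩
  · rw [← sub_eq_zero]
    exact h.isFiniteSum.eq_zero_of_comp_eq_zero h.eq_zero _ (by simp [Preadditive.sub_comp, ha, hb])
  · rw [← sub_eq_zero]
    exact h'.isFiniteSum.eq_zero_of_comp_eq_zero h'.eq_zero _
      (by simp [Preadditive.sub_comp, ha, hb])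

lemma biprod {S : ShortComplex C} (hS : S.ShortExact) {P₁ P₃ : C} {p₁ : P₁ ⟶ S.X₁}
    {q : P₃ ⟶ S.X₂} (h₁ : IsApprox E p₁) (h₃ : IsApprox E (q ≫ S.g)) :
    IsApprox E (biprod.desc (p₁ ≫ S.f) q) where
  isFiniteSum := h₁.isFiniteSum.biprod h₃.isFiniteSum
  eq_zero g hg := by
    have := hS.mono_f
    have hsum : (g ≫ biprod.fst) ≫ p₁ ≫ S.f + (g ≫ biprod.snd) ≫ q = 0 := by
      rw [← hg, biprod.desc_eq, Preadditive.comp_add, Category.assoc, Category.assoc]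
    have hsnd : g ≫ biprod.snd = 0 :=
      h₃.eq_zero _ (by simpa using congrArg (· ≫ S.g) hsum)
    rw [hsnd, zero_comp, add_zero] at hsum
    have hfst : g ≫ biprod.fst = 0 :=
      h₁.eq_zero _ (by rw [← cancel_mono S.f, zero_comp, ← hsum, Category.assoc])
    exact biprod.hom_ext _ _ (by rw [hfst, zero_comp]) (by rw [hsnd, zero_comp])
  exists_lift g := by
    have := hS.mono_f
    obtain ⟨b, hb⟩ := h₃.exists_lift (g ≫ S.g)
    have hg : (g - b ≫ q) ≫ S.g = 0 := by simp [Preadditive.sub_comp, hb]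
    obtain ⟨a, ha⟩ := h₁.exists_lift (hS.exact.lift _ hg)
    refine ⟨biprod.lift a b, ?_⟩
    rw [biprod.lift_desc, reassoc_of% ha, hS.exact.lift_f, sub_add_cancel]

variable [HasExt.{w} C] (hE : extOneVanish.{w} E E) {P X : C} {p : P ⟶ X} (hp : IsApprox E p)
include hE hp

lemma perp_kernel : perp.{w} E (kernel p) := by
  refine ⟨fun g => ?_, extOneVanish_of_exists_lift (shortExact_cokernel (kernel.ι p))
    (hp.isFiniteSum.prop hE) fun g => ?_⟩
  · rw [← cancel_mono (kernel.ι p), zero_comp]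
    exact hp.eq_zero _ (by simp)
  · obtain ⟨g', hg'⟩ := hp.exists_lift (g ≫ Abelian.factorThruCoimage p)
    refine ⟨g', ?_⟩
    rw [← cancel_mono (Abelian.factorThruCoimage p), ← hg']
    simp

lemma perp_cokernel [HasProjectiveDimensionLE E 1] (hX : extOneVanish.{w} E X) :
    perp.{w} E (cokernel p) := by
  have h_image : extOneVanish.{w} E (Abelian.image p) :=
    (extOneVanish E).prop_of_epi (Abelian.factorThruImage p) (hp.isFiniteSum.prop hE)
  refine ⟨fun g => ?_, (extOneVanish E).prop_of_epi (cokernel.π p) hX⟩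
  obtain ⟨g', rfl⟩ := exists_lift_of_extOneVanish (shortExact_kernel (cokernel.π p)) h_image g
  obtain ⟨g'', rfl⟩ := hp.exists_lift g'
  simp

end IsApprox

variable [HasExt.{w} C] [HasProjectiveDimensionLE E 1] {A : ObjectProperty C} [IsWide A]
  (hEA : A E) (hE : extOneVanish.{w} E E)
  (happrox : ∀ X : C, ∃ (P : C) (p : P ⟶ X), IsApprox E p)
include hEA hE

lemma IsApprox.isFredholm {P X : C} {p : P ⟶ X} (hp : IsApprox E p)
    (hX : (A ⊓ extOneVanish.{w} E) X) : IsFredholm (A ⊓ perp.{w} E) p :=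
  have hP : A P := hp.isFiniteSum.prop hEA
  ⟨⟨A.prop_kernel p hP hX.1, hp.perp_kernel hE⟩,
    ⟨A.prop_cokernel p hP hX.1, hp.perp_cokernel hE hX.2⟩⟩

/-- A short exact sequence lifts to a morphism of short exact sequences from a split one made
of approximations, as in the horseshoe lemma. -/
lemma IsAdditiveOn.fredholmIndex_approx {M : Type*} [AddCommGroup M] {f : C → M}
    (hf : IsAdditiveOn (A ⊓ perp.{w} E) f) {S : ShortComplex C} (hS : S.ShortExact)
    (h₁ : (A ⊓ extOneVanish.{w} E) S.X₁) (h₂ : (A ⊓ extOneVanish.{w} E) S.X₂)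
    (h₃ : (A ⊓ extOneVanish.{w} E) S.X₃) {P₁ P₂ P₃ : C} {p₁ : P₁ ⟶ S.X₁} {p₂ : P₂ ⟶ S.X₂}
    {p₃ : P₃ ⟶ S.X₃} (hp₁ : IsApprox E p₁) (hp₂ : IsApprox E p₂) (hp₃ : IsApprox E p₃) :
    fredholmIndex f p₂ = fredholmIndex f p₁ + fredholmIndex f p₃ := by
  obtain ⟨q, rfl⟩ := hp₃.isFiniteSum.exists_lift (exists_lift_of_extOneVanish hS h₁.2) p₃
  have hq := IsApprox.biprod hS hp₁ hp₃
  obtain ⟨e, he⟩ := hq.exists_iso hp₂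
  let φ : ShortComplex.mk (biprod.inl : P₁ ⟶ P₁ ⊞ P₃) biprod.snd biprod.inl_snd ⟶ S :=
    { τ₁ := p₁
      τ₂ := biprod.desc (p₁ ≫ S.f) q
      τ₃ := q ≫ S.g
      comm₁₂ := by simp
      comm₂₃ := by dsimp; ext <;> simp }
  rw [← hf.fredholmIndex_congr e he (hq.isFredholm hEA hE h₂)]
  exact hf.fredholmIndex_add (ShortComplex.Splitting.ofHasBinaryBiproduct P₁ P₃).shortExact hS φ
    (hp₁.isFredholm hEA hE h₁) (hq.isFredholm hEA hE h₂) (hp₃.isFredholm hEA hE h₃)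

include happrox

/-- The extension sends `X` to the index of its minimal right `add E`-approximation. -/
lemma exists_isAdditiveOn_extOneVanish {M : Type*} [AddCommGroup M] {f : C → M}
    (hf : IsAdditiveOn (A ⊓ perp.{w} E) f) :
    ∃ g : C → M, IsAdditiveOn (A ⊓ extOneVanish.{w} E) g ∧
      (∀ X, (A ⊓ perp.{w} E) X → g X = f X) ∧ g E = 0 := by
  choose P p hp using happrox
  have h_index {P' X : C} {p' : P' ⟶ X} (h : IsApprox E p') (hX : (A ⊓ extOneVanish.{w} E) X) :
      fredholmIndex f (p X) = fredholmIndex f p' := by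
    obtain ⟨e, he⟩ := (hp X).exists_iso h
    exact hf.fredholmIndex_congr e he ((hp X).isFredholm hEA hE hX)
  have h_zero {Z : C} (hZ : IsZero Z) : f Z = 0 :=
    hf.map_isZero hZ ((A ⊓ perp E).prop_of_isZero hZ)
  refine ⟨fun X => fredholmIndex f (p X), fun S hS h₁ h₂ h₃ =>
    hf.fredholmIndex_approx hEA hE hS h₁ h₂ h₃ (hp _) (hp _) (hp _), fun X hX => ?_, ?_⟩
  · beta_reduce
    have h0 := IsApprox.of_eq_zero hX.2.1 (isZero_zero C)
    rw [h_index h0 ⟨hX.1, hX.2.2⟩, fredholmIndex,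
      h_zero ((isZero_zero C).of_iso kernelZeroIsoSource), sub_zero]
    exact (hf.congr_of_iso cokernelZeroIsoTarget.symm hX).symm
  · beta_reduce
    rw [h_index .self ⟨hEA, hE⟩, fredholmIndex, h_zero (isZero_cokernel_of_epi _),
      h_zero (isZero_kernel_of_mono _), sub_zero]

variable (k : Type*) [Field k] [Linear k C] [∀ X : C, Module.Finite k (Ext.{w} E X 1)]
include k

lemma exists_isAdditiveOn_of_perp {M : Type*} [AddCommGroup M] {f : C → M}
    (hf : IsAdditiveOn (A ⊓ perp.{w} E) f) :
    ∃ g : C → M, IsAdditiveOn A g ∧ (∀ X, (A ⊓ perp.{w} E) X → g X = f X) ∧ g E = 0 := by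
  obtain ⟨g, hg, hgf, hgE⟩ := exists_isAdditiveOn_extOneVanish hEA hE happrox hf
  have : (A ⊓ extOneVanish.{w} E).IsClosedUnderExtensions := ⟨fun hS h₁ h₃ =>
    ⟨A.prop_X₂_of_shortExact hS h₁.1 h₃.1,
      (extOneVanish E).prop_X₂_of_shortExact hS h₁.2 h₃.2⟩⟩
  obtain ⟨h, hh, hhg⟩ := exists_isAdditiveOn_of_coresolution inf_le_left
    (fun X Y p _ hX hY => ⟨hY, (extOneVanish E).prop_of_epi p hX.2⟩)
    (fun X hX => by
      obtain ⟨Y, i, hi, hY, hA⟩ := exists_universal_extension k hE hEA X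
      exact ⟨Y, i, hi, A.prop_X₂_of_shortExact (shortExact_cokernel i) hX hA, hY⟩) hg
  exact ⟨h, hh, fun X hX => (hhg X ⟨hX.1, hX.2.2⟩).trans (hgf X hX),
    (hhg E ⟨hEA, hE⟩).trans hgE⟩

end PerpendicularExtension

section Devissage

open Abelian

variable {C : Type u} [Category.{v} C] [Abelian C]

/-- If two of the terms of a short exact sequence satisfy `Q`, so does the third. -/
class HasTwoOutOfThree (Q : ObjectProperty C) : Prop extends
    Q.ContainsZero, Q.IsClosedUnderExtensions where
  prop_X₁_of_shortExact ⦃S : ShortComplex C⦄ (hS : S.ShortExact) : Q S.X₂ → Q S.X₃ → Q S.X₁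
  prop_X₃_of_shortExact ⦃S : ShortComplex C⦄ (hS : S.ShortExact) : Q S.X₁ → Q S.X₂ → Q S.X₃

variable {Q : ObjectProperty C} [HasTwoOutOfThree Q]

lemma HasTwoOutOfThree.prop_of_kernel_of_cokernel {P X : C} (p : P ⟶ X) (hP : Q P)
    (hK : Q (kernel p)) (hQ : Q (cokernel p)) : Q X := by
  have hI : Q (Abelian.coimage p) :=
    prop_X₃_of_shortExact (shortExact_cokernel (kernel.ι p)) hK hP
  exact Q.prop_X₂_of_shortExact (shortExact_kernel (cokernel.π p))
    (Q.prop_of_iso (Abelian.coimageIsoImage p) hI) hQ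

lemma prop_of_perp (k : Type*) [Field k] [Linear k C] [HasExt.{w} C] {A : ObjectProperty C}
    [IsWide A] {E : C} [HasProjectiveDimensionLE E 1] [∀ X : C, Module.Finite k (Ext.{w} E X 1)]
    (hEA : A E) (hE : extOneVanish.{w} E E)
    (happrox : ∀ X : C, ∃ (P : C) (p : P ⟶ X), IsApprox E p)
    (hQE : Q E) (hQ : A ⊓ perp.{w} E ≤ Q) : A ≤ Q := by
  intro X hX
  have : (A ⊓ Q).IsClosedUnderExtensions := ⟨fun hS h₁ h₃ =>
    ⟨A.prop_X₂_of_shortExact hS h₁.1 h₃.1, Q.prop_X₂_of_shortExact hS h₁.2 h₃.2⟩⟩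
  obtain ⟨Y, i, hi, hY, hAcoker, hQcoker⟩ :=
    exists_universal_extension k hE (W := A ⊓ Q) ⟨hEA, hQE⟩ X
  have hYA : A Y := A.prop_X₂_of_shortExact (shortExact_cokernel i) hX hAcoker
  obtain ⟨P, p, hp⟩ := happrox Y
  have hp' := hp.isFredholm hEA hE ⟨hYA, hY⟩
  have hYQ : Q Y := HasTwoOutOfThree.prop_of_kernel_of_cokernel p (hp.isFiniteSum.prop hQE)
    (hQ _ hp'.kernel) (hQ _ hp'.cokernel)
  exact HasTwoOutOfThree.prop_X₁_of_shortExact (shortExact_cokernel i) hYQ hQcoker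

end Devissage

section EulerForm

open Abelian

variable {C : Type u} [Category.{v} C] [Abelian C] [HasExt.{w} C] (k : Type*) [Field k]
  [Linear k C]

/-- The Euler form `∑ (-1)ⁱ dim Extⁱ(E, X)` for an object `E` of projective dimension at most
one. -/
noncomputable def eulerForm (E X : C) : ℤ :=
  Module.finrank k (E ⟶ X) - Module.finrank k (Ext.{w} E X 1)

lemma isAdditiveOn_eulerForm (E : C) [HasProjectiveDimensionLE E 1]
    [∀ X : C, Module.Finite k (E ⟶ X)] [∀ X : C, Module.Finite k (Ext.{w} E X 1)] :
    IsAdditiveOn (⊤ : ObjectProperty C) (eulerForm.{w} k E) := by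
  intro S hS _ _ _
  have := hS.mono_f
  have (X : C) : Module.Finite k (Ext.{w} E X 0) := .equiv (Ext.linearEquiv₀ (R := k)).symm
  have h_inj : Function.Injective ((Ext.mk₀ S.f).postcompOfLinear k E (add_zero 0)) :=
    Ext.postcomp_mk₀_injective_of_mono E S.f
  have h_exact (m : ℕ) : Function.Exact ((Ext.mk₀ S.f).postcompOfLinear k E (add_zero m))
      ((Ext.mk₀ S.g).postcompOfLinear k E (add_zero m)) :=
    (ShortComplex.ab_exact_iff_function_exact _).1 (Ext.covariant_sequence_exact₂' E hS m)
  have h_exact₃ : Function.Exact ((Ext.mk₀ S.g).postcompOfLinear k E (add_zero 0))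
      (hS.extClass.postcompOfLinear k E (zero_add 1)) :=
    (ShortComplex.ab_exact_iff_function_exact _).1
      (Ext.covariant_sequence_exact₃' E hS 0 1 (zero_add 1))
  have h_exact₁ : Function.Exact (hS.extClass.postcompOfLinear k E (zero_add 1))
      ((Ext.mk₀ S.f).postcompOfLinear k E (add_zero 1)) :=
    (ShortComplex.ab_exact_iff_function_exact _).1
      (Ext.covariant_sequence_exact₁' E hS 0 1 (zero_add 1))
  have h_surj : Function.Surjective ((Ext.mk₀ S.g).postcompOfLinear k E (add_zero 1)) :=
    exists_ext_lift hS
  have h := Module.sum_neg_one_pow_finrank_eq_zero_of_exact_six _ _ _ _ _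
    h_inj (h_exact 0) h_exact₃ h_exact₁ (h_exact 1) h_surj
  simp only [eulerForm, ← (Ext.linearEquiv₀.{w} (R := k) (X := E)).finrank_eq]
  linarith

end EulerForm

section KrullDimension

variable {C : Type u} [Category.{v} C] [Abelian C]

lemma exists_isAdditiveOn_finiteLengthModSerre (P : ObjectProperty C) [P.IsSerreClass] :
    ∃ f : C → ℤ, IsAdditiveOn (finiteLengthModSerre P) f ∧
      ∀ X, finiteLengthModSerre P X → f X = 0 → P X := by
  let := ObjectProperty.SerreClassLocalization.abelian P.isoModSerre.Q P
  have := ObjectProperty.SerreClassLocalization.preservesFiniteLimits P.isoModSerre.Q P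
  have := ObjectProperty.SerreClassLocalization.preservesFiniteColimits P.isoModSerre.Q P
  refine ⟨fun X => ((objLength (P.isoModSerre.Q.obj X)).toNat : ℤ), ?_, ?_⟩
  · intro S hS h₁ _ h₃
    have h := objLength_eq_add (hS.map_of_exact P.isoModSerre.Q)
    simp only [ShortComplex.map_X₁, ShortComplex.map_X₂, ShortComplex.map_X₃] at h
    beta_reduce
    rw [h, ENat.toNat_add (objLength_ne_top h₁) (objLength_ne_top h₃), Nat.cast_add]
  · intro X hX h
    beta_reduce at h
    rw [← ObjectProperty.SerreClassLocalization.isZero_obj_iff P.isoModSerre.Q P,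
      ← objLength_eq_zero_iff, ← ENat.natCast_toNat (objLength_ne_top hX)]
    exact_mod_cast h

lemma exists_isAdditiveOn_ne_zero (hC : HasFiniteKrullDimension C) {A : ObjectProperty C} {X : C}
    (hX : A X) (hX0 : ¬ IsZero X) : ∃ f : C → ℤ, IsAdditiveOn A f ∧ ∃ Y, A Y ∧ f Y ≠ 0 := by
  classical
  have hex : ∃ n, A ≤ krullFiltration C n := hC.imp fun n hn X _ => hn X
  obtain ⟨m, hm, hmin⟩ : ∃ m, A ≤ krullFiltration C m ∧ ∀ l < m, ¬ A ≤ krullFiltration C l :=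
    ⟨Nat.find hex, Nat.find_spec hex, fun l => Nat.find_min hex⟩
  obtain _ | p := m
  · exact absurd (hm X hX) hX0
  have : (krullFiltration C p).IsSerreClass := (krullFiltrationAux C p).2
  have hm : A ≤ finiteLengthModSerre (krullFiltration C p) := hm
  obtain ⟨f, hf, hf0⟩ := exists_isAdditiveOn_finiteLengthModSerre (krullFiltration C p)
  refine ⟨f, hf.mono hm, ?_⟩
  by_contra! h
  exact hmin p p.lt_succ_self fun Y hY => hf0 Y (hm _ hY) (h Y hY)

end KrullDimension

section GrothendieckGroup

variable {C : Type u} [Category.{v} C] [Abelian C]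

/-- The class of an object in the Grothendieck group. -/
def classK₀ (X : C) : K₀ C :=
  QuotientAddGroup.mk (FreeAbelianGroup.of X)

/-- The homomorphism on the Grothendieck group induced by an additive function. -/
def IsAdditiveOn.liftK₀ {M : Type*} [AddCommGroup M] {f : C → M} (hf : IsAdditiveOn ⊤ f) :
    K₀ C →+ M :=
  QuotientAddGroup.lift (K₀Relations C) (FreeAbelianGroup.lift f) <| by
    rw [K₀Relations, AddSubgroup.closure_le]
    rintro _ ⟨S, hS, rfl⟩
    simp [hf hS trivial trivial trivial]

@[simp]
lemma IsAdditiveOn.liftK₀_classK₀ {M : Type*} [AddCommGroup M] {f : C → M}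
    (hf : IsAdditiveOn ⊤ f) (X : C) : hf.liftK₀ (classK₀ X) = f X := by
  simp [liftK₀, classK₀]

end GrothendieckGroup

section LinearIndependent

lemma linearIndependent_of_triangular {R M ι : Type*} [CommRing R] [IsDomain R] [AddCommGroup M]
    [Module R M] [Finite ι] [LinearOrder ι] {v : ι → M} (φ : ι → M →ₗ[R] R)
    (h_lt : ∀ i j, i < j → φ i (v j) = 0) (h_diag : ∀ i, φ i (v i) ≠ 0) :
    LinearIndependent R v := by
  have := Fintype.ofFinite ι
  let A : Matrix ι ι R := Matrix.of fun i j => φ j (v i)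
  have hA : A.IsUpperTriangular := fun i j hij => h_lt j i hij
  refine LinearIndependent.of_comp (LinearMap.pi φ)
    (A.linearIndependent_rows_of_det_ne_zero ?_)
  rw [Matrix.det_of_isUpperTriangular hA]
  exact Finset.prod_ne_zero_iff.2 fun i _ => h_diag i

end LinearIndependent

section ExceptionalCollection

open Abelian

variable {C : Type u} [Category.{v} C] [Abelian C] [HasExt.{w} C]

lemma hom_eq_zero_of_subsingleton_ext {X Y : C} [Subsingleton (Ext.{w} X Y 0)] (f : X ⟶ Y) :
    f = 0 :=
  Ext.homEquiv₀.{w}.symm.injective (Subsingleton.elim _ _)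

lemma IsExceptional.exists_isApprox (k : Type*) [Field k] [Linear k C] {E : C}
    [∀ X : C, Module.Finite k (E ⟶ X)] (hE : IsExceptional.{w} E) (X : C) :
    ∃ (P : C) (p : P ⟶ X), IsApprox E p := by
  refine TiltingTheory.exists_isApprox k (fun h0 => ?_) hE.isUnit_of_ne_zero X
  have := hE.nontrivial_end
  exact one_ne_zero (α := End E) (h0.eq_of_src _ _)

lemma IsExceptional.eulerForm_self_ne_zero (k : Type*) [Field k] [Linear k C] {E : C}
    [Module.Finite k (E ⟶ E)] (hE : IsExceptional.{w} E) : eulerForm.{w} k E E ≠ 0 := by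
  have : Nontrivial (E ⟶ E) := hE.nontrivial_end
  have : Subsingleton (Ext.{w} E E 1) := hE.ext_self 1 one_pos
  rw [eulerForm, Module.finrank_zero_of_subsingleton (M := Ext.{w} E E 1), Nat.cast_zero, sub_zero]
  exact_mod_cast (Module.finrank_pos (R := k) (M := E ⟶ E)).ne'

lemma eulerForm_eq_zero_of_perp (k : Type*) [Field k] [Linear k C] {E X : C} (h : perp.{w} E X) :
    eulerForm.{w} k E X = 0 := by
  have : Subsingleton (E ⟶ X) := subsingleton_of_forall_eq 0 h.1
  have : Subsingleton (Ext.{w} E X 1) := h.2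
  simp [eulerForm, Module.finrank_zero_of_subsingleton]

/-- The objects which are right perpendicular to `T j` for all `j < m`. For `m = n` this is the
right perpendicular category of the whole collection, for `m = 0` it is everything. -/
def perpBelow {n : ℕ} (T : Fin n → C) (m : ℕ) : ObjectProperty C :=
  fun X => ∀ j : Fin n, (j : ℕ) < m → perp.{w} (T j) X

variable {n : ℕ} {T : Fin n → C}

lemma perpBelow_zero : perpBelow.{w} T 0 = ⊤ :=
  eq_top_iff.2 fun _ _ j hj => absurd hj j.val.not_lt_zero

lemma perpBelow_succ {m : ℕ} (hm : m < n) :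
    perpBelow.{w} T (m + 1) = perpBelow.{w} T m ⊓ perp.{w} (T ⟨m, hm⟩) := by
  ext X
  refine ⟨fun h => ⟨fun j hj => h j (by omega), h ⟨m, hm⟩ m.lt_succ_self⟩, fun h j hj => ?_⟩
  rcases Nat.lt_succ_iff_lt_or_eq.1 hj with hj | hj
  · exact h.1 j hj
  · obtain rfl : j = ⟨m, hm⟩ := Fin.ext hj
    exact h.2

lemma isWide_perpBelow (hpd : ∀ i, HasProjectiveDimensionLE (T i) 1) {m : ℕ} (hm : m ≤ n) :
    IsWide (perpBelow.{w} T m) := by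
  induction m with
  | zero => rw [perpBelow_zero]; infer_instance
  | succ m ih => rw [perpBelow_succ hm]; have := ih (by omega); infer_instance

namespace IsExceptionalCollection

variable (hT : IsExceptionalCollection.{w} T)
include hT

lemma perp_of_lt {i j : Fin n} (hij : i < j) : perp.{w} (T i) (T j) :=
  have := hT.ext_of_lt i j hij 0
  ⟨hom_eq_zero_of_subsingleton_ext.{w}, hT.ext_of_lt i j hij 1⟩

lemma perpBelow_of_le {m : ℕ} {i : Fin n} (hm : m ≤ i) : perpBelow.{w} T m (T i) :=
  fun _ hj => hT.perp_of_lt (hj.trans_le hm)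

variable (k : Type*) [Field k] [Linear k C] [∀ i X, Module.Finite k (T i ⟶ X)]
  [∀ i X, Module.Finite k (Ext.{w} (T i) X 1)] [∀ i, HasProjectiveDimensionLE (T i) 1]
include k

lemma exists_isAdditiveOn_perpBelow {M : Type*} [AddCommGroup M] {f : C → M}
    (hf : IsAdditiveOn (perpBelow.{w} T n) f) {m : ℕ} (hm : m ≤ n) :
    ∃ g : C → M, IsAdditiveOn (perpBelow.{w} T m) g ∧ (∀ X, perpBelow.{w} T n X → g X = f X) ∧
      ∀ j : Fin n, m ≤ j → g (T j) = 0 := by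
  induction hm using Nat.decreasingInduction with
  | self => exact ⟨f, hf, fun _ _ => rfl, fun j hj => absurd j.2 hj.not_gt⟩
  | of_succ m hm ih =>
    obtain ⟨g, hg, hgf, hgT⟩ := ih
    rw [perpBelow_succ hm] at hg
    have : IsWide (perpBelow.{w} T m) := isWide_perpBelow inferInstance hm.le
    obtain ⟨g', hg', hg'g, hg'E⟩ := exists_isAdditiveOn_of_perp (E := T ⟨m, hm⟩)
      (hT.perpBelow_of_le le_rfl) ((hT.isExceptional ⟨m, hm⟩).ext_self 1 one_pos)
      ((hT.isExceptional _).exists_isApprox k) k hg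
    rw [← perpBelow_succ hm] at hg'g
    refine ⟨g', hg', fun X hX => ?_, fun j hj => ?_⟩
    · rw [hg'g X fun j _ => hX j j.2, hgf X hX]
    · rcases hj.lt_or_eq with hj | hj
      · rw [hg'g _ (hT.perpBelow_of_le hj), hgT j hj]
      · obtain rfl : j = ⟨m, hm⟩ := Fin.ext hj.symm
        exact hg'E

lemma exists_isAdditiveOn {M : Type*} [AddCommGroup M] {f : C → M}
    (hf : IsAdditiveOn (perpBelow.{w} T n) f) :
    ∃ g : C → M, IsAdditiveOn ⊤ g ∧ (∀ X, perpBelow.{w} T n X → g X = f X) ∧ ∀ j, g (T j) = 0 := by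
  obtain ⟨g, hg, hgf, hgT⟩ := hT.exists_isAdditiveOn_perpBelow k hf n.zero_le
  exact ⟨g, perpBelow_zero (T := T) ▸ hg, hgf, fun j => hgT j (Nat.zero_le _)⟩

lemma prop_of_perpBelow {Q : ObjectProperty C} [HasTwoOutOfThree Q] (hQT : ∀ i, Q (T i))
    (hQ : perpBelow.{w} T n ≤ Q) (X : C) : Q X := by
  suffices h : ∀ m ≤ n, perpBelow.{w} T m ≤ Q from
    h 0 n.zero_le X (perpBelow_zero (T := T) ▸ trivial)
  intro m hm
  induction hm using Nat.decreasingInduction with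
  | self => exact hQ
  | of_succ m hm ih =>
    rw [perpBelow_succ hm] at ih
    have : IsWide (perpBelow.{w} T m) := isWide_perpBelow inferInstance hm.le
    exact TiltingTheory.prop_of_perp k (hT.perpBelow_of_le le_rfl)
      ((hT.isExceptional ⟨m, hm⟩).ext_self 1 one_pos) ((hT.isExceptional _).exists_isApprox k)
      (hQT _) ih

lemma linearIndependent_cons (g : K₀ C →+ ℤ) {Y : C}
    (hg : ∀ j, g (classK₀ (T j)) = 0) (hY : g (classK₀ Y) ≠ 0) :
    LinearIndependent ℤ (Fin.cons (classK₀ Y) fun j => classK₀ (T j) : Fin (n + 1) → K₀ C) := by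
  let χ (i : Fin n) : K₀ C →+ ℤ := (isAdditiveOn_eulerForm.{w} k (T i)).liftK₀
  refine linearIndependent_of_triangular (Fin.cons g.toIntLinearMap fun i => (χ i).toIntLinearMap)
    (fun i j hij => ?_) fun i => ?_
  · cases j using Fin.cases with
    | zero => exact absurd hij (Fin.not_lt_zero i)
    | succ j =>
      cases i using Fin.cases with
      | zero => exact hg j
      | succ i =>
        simpa [χ] using eulerForm_eq_zero_of_perp k (hT.perp_of_lt (Fin.succ_lt_succ_iff.1 hij))
  · cases i using Fin.cases with
    | zero => exact hY
    | succ i => simpa [χ] using (hT.isExceptional i).eulerForm_self_ne_zero k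

lemma isZero_of_perpBelow (hC : HasFiniteKrullDimension C)
    (hrank : Module.rank ℤ (K₀ C) ≤ n) {X : C} (hX : perpBelow.{w} T n X) : IsZero X := by
  by_contra hX0
  obtain ⟨f, hf, Y, hY, hfY⟩ := exists_isAdditiveOn_ne_zero hC hX hX0
  obtain ⟨g, hg, hgf, hgT⟩ := hT.exists_isAdditiveOn k hf
  have h_card := (hT.linearIndependent_cons k hg.liftK₀ (Y := Y) (by simpa using hgT)
    (by simpa [hgf Y hY] using hfY)).cardinal_lift_le_rank
  have h_le := h_card.trans (Cardinal.lift_le.2 hrank)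
  simp only [Cardinal.mk_fintype, Fintype.card_fin, Cardinal.lift_natCast, Nat.cast_le] at h_le
  exact absurd h_le n.not_succ_le_self

end IsExceptionalCollection

end ExceptionalCollection

section Triangulated

open Pretriangulated Triangulated

lemma exists_distinguished_of_map {A D : Type*} [Category* A] [Category* D] [HasZeroObject A]
    [HasZeroObject D] [HasShift A ℤ] [HasShift D ℤ] [Preadditive A] [Preadditive D]
    [∀ n : ℤ, (shiftFunctor A n).Additive] [∀ n : ℤ, (shiftFunctor D n).Additive]
    [Pretriangulated A] [Pretriangulated D] (F : A ⥤ D) [F.CommShift ℤ] [F.IsTriangulated]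
    [F.Full] [F.Faithful] {X Y Z : A} {f : F.obj X ⟶ F.obj Y} {g : F.obj Y ⟶ F.obj Z}
    {h : F.obj Z ⟶ (F.obj X)⟦(1 : ℤ)⟧} (hT : Triangle.mk f g h ∈ distTriang D) :
    ∃ (f' : X ⟶ Y) (g' : Y ⟶ Z) (h' : Z ⟶ X⟦(1 : ℤ)⟧), Triangle.mk f' g' h' ∈ distTriang A := by
  refine ⟨F.preimage f, F.preimage g, F.preimage (h ≫ (F.commShiftIso (1 : ℤ)).inv.app X), ?_⟩
  rw [← F.map_distinguished_iff]
  exact isomorphic_distinguished _ hT _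
    (Triangle.isoMk _ _ (Iso.refl _) (Iso.refl _) (Iso.refl _)
      (show F.map (F.preimage f) ≫ 𝟙 _ = 𝟙 _ ≫ f by simp)
      (show F.map (F.preimage g) ≫ 𝟙 _ = 𝟙 _ ≫ g by simp)
      (show (F.map (F.preimage (h ≫ (F.commShiftIso (1 : ℤ)).inv.app X)) ≫
        (F.commShiftIso (1 : ℤ)).hom.app X) ≫ (𝟙 (F.obj X))⟦(1 : ℤ)⟧' = 𝟙 _ ≫ h by simp))

lemma addClosure_of_retract {A : Type*} [Category* A] [Preadditive A] [HasFiniteBiproducts A]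
    {X Y : A} (r : Retract X Y) : addClosure Y X :=
  ⟨1, ⟨r.trans ⟨biproduct.ι (fun _ : Fin 1 => Y) 0, biproduct.π (fun _ : Fin 1 => Y) 0,
    biproduct.ι_π_self _ _⟩⟩⟩

variable {D : Type*} [Category* D] [HasZeroObject D] [HasShift D ℤ] [Preadditive D]
  [∀ n : ℤ, (shiftFunctor D n).Additive] [Pretriangulated D] [IsTriangulated D]
  (t : TStructure D) {P : ObjectProperty D} [P.IsTriangulated] [P.IsClosedUnderIsomorphisms]

lemma prop_of_heart_le (hP : t.heart ≤ P) {X : D} {a b : ℤ} (ha : t.IsGE X a) (hb : t.IsLE X b) :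
    P X := by
  have prop_of_single (X : D) (a : ℤ) (_ : t.IsGE X a) (_ : t.IsLE X a) : P X :=
    P.prop_of_iso (shiftShiftNeg X a) <| P.le_shift (-a) _ <| hP _ <|
      (t.mem_heart_iff _).2 ⟨t.isLE_shift X a a 0, t.isGE_shift X a a 0⟩
  have prop_of_amplitude (n : ℕ) (X : D) (a b : ℤ) (hab : a + n = b) (_ : t.IsGE X a)
      (_ : t.IsLE X b) : P X := by
    induction n generalizing X a with
    | zero =>
      obtain rfl : a = b := by lia
      exact prop_of_single X a ‹_› ‹_›
    | succ n ih =>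
      exact P.ext_of_isTriangulatedClosed₂ _ (t.triangleLEGE_distinguished a (a + 1) rfl X)
        (prop_of_single ((t.truncLE a).obj X) a inferInstance inferInstance)
        (ih ((t.truncGE (a + 1)).obj X) (a + 1) (by lia) inferInstance inferInstance)
  exact prop_of_amplitude (max a b - a).toNat X a (max a b) (by lia) ha
    (t.isLE_of_le X b (max a b))

end Triangulated

section BoundedDerived

open Abelian Pretriangulated DerivedCategory

variable {C : Type u} [Category.{v} C] [Abelian C] [HasDerivedCategory.{w'} C]

lemma exists_distinguished_toBounded {S : ShortComplex C} (hS : S.ShortExact) :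
    ∃ (f : toBounded.{w'} S.X₁ ⟶ toBounded.{w'} S.X₂)
      (g : toBounded.{w'} S.X₂ ⟶ toBounded.{w'} S.X₃)
      (h : toBounded.{w'} S.X₃ ⟶ (toBounded.{w'} S.X₁)⟦(1 : ℤ)⟧),
        Triangle.mk f g h ∈ distTriang (BoundedDerivedCategory.{w'} C) :=
  exists_distinguished_of_map (TStructure.t (C := C)).bounded.ι hS.singleTriangle_distinguished

/-- The embedding `toBounded` of the heart, as a functor. -/
noncomputable def toBoundedFunctor (C : Type u) [Category.{v} C] [Abelian C]
    [HasDerivedCategory.{w'} C] : C ⥤ BoundedDerivedCategory.{w'} C :=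
  TStructure.t.bounded.lift (singleFunctor C 0) fun X => (toBounded X).property

lemma isZero_toBounded {X : C} (hX : IsZero X) : IsZero (toBounded.{w'} X) := by
  rw [IsZero.iff_id_eq_zero]
  apply (TStructure.t (C := C)).bounded.ι.map_injective
  exact ((singleFunctor C 0).map_isZero hX).eq_of_src _ _

lemma toBounded_hom_shift_eq_zero [HasExt.{w} C] {X Y : C}
    (h : ∀ m : ℕ, 0 < m → Subsingleton (Ext.{w} X Y m)) (i : ℤ) (hi : i ≠ 0)
    (f : toBounded.{w'} X ⟶ (toBounded.{w'} Y)⟦i⟧) : f = 0 := by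
  let ι := (TStructure.t (C := C)).bounded.ι
  suffices ∀ g : (singleFunctor C 0).obj X ⟶ ((singleFunctor C 0).obj Y)⟦i⟧, g = 0 by
    apply ι.map_injective
    rw [Functor.map_zero, ← cancel_mono ((ι.commShiftIso i).hom.app (toBounded.{w'} Y)), zero_comp]
    exact this _
  intro g
  rcases lt_or_gt_of_ne hi with hi | hi
  · exact singleFunctor_hom_shift_eq_zero g hi
  · obtain ⟨m, rfl⟩ := Int.eq_ofNat_of_zero_le hi.le
    have := h m (by lia)
    exact (Ext.homEquiv (C := C) (X := X) (Y := Y) (n := m)).symm.injective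
      (Subsingleton.elim _ _)

variable (P : ObjectProperty (BoundedDerivedCategory.{w'} C)) [P.IsTriangulated]
  [P.IsClosedUnderIsomorphisms]

lemma prop_of_prop_toBounded (hP : ∀ X : C, P (toBounded.{w'} X))
    (X : BoundedDerivedCategory.{w'} C) : P X := by
  let t := TStructure.t (C := C)
  have heart_le : t.onBounded.heart ≤ P := by
    intro Y hY
    have hle : t.IsLE Y.obj 0 := (t.bounded.tStructure_isLE_iff t Y 0).1 ⟨hY.1⟩
    have hge : t.IsGE Y.obj 0 := (t.bounded.tStructure_isGE_iff t Y 0).1 ⟨hY.2⟩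
    obtain ⟨Z, ⟨e⟩⟩ := exists_iso_singleFunctor_obj_of_isGE_of_isLE Y.obj 0
    have e' : t.bounded.ι.obj (toBounded.{w'} Z) ≅ t.bounded.ι.obj Y := e.symm
    exact P.prop_of_iso (t.bounded.fullyFaithfulι.preimageIso e') (hP Z)
  obtain ⟨⟨a, ha⟩, ⟨b, hb⟩⟩ := X.property
  exact prop_of_heart_le t.onBounded heart_le ((t.bounded.tStructure_isGE_iff t X a).2 ha)
    ((t.bounded.tStructure_isLE_iff t X b).2 hb)

lemma hasTwoOutOfThree_toBounded : HasTwoOutOfThree fun X : C => P (toBounded.{w'} X) where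
  exists_zero := ⟨_, isZero_zero C, P.prop_of_isZero (isZero_toBounded (isZero_zero C))⟩
  prop_X₁_of_shortExact _ hS h₂ h₃ := by
    obtain ⟨f, g, h, hD⟩ := exists_distinguished_toBounded.{w'} hS
    exact P.ext_of_isTriangulatedClosed₁ _ hD h₂ h₃
  prop_X₂_of_shortExact hS h₁ h₃ := by
    obtain ⟨f, g, h, hD⟩ := exists_distinguished_toBounded.{w'} hS
    exact P.ext_of_isTriangulatedClosed₂ _ hD h₁ h₃
  prop_X₃_of_shortExact _ hS h₁ h₂ := by
    obtain ⟨f, g, h, hD⟩ := exists_distinguished_toBounded.{w'} hS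
    exact P.ext_of_isTriangulatedClosed₃ _ hD h₁ h₂

lemma addClosure_toBounded_biproduct {ι : Type} [Finite ι] (T : ι → C) (i : ι) :
    addClosure (toBounded.{w'} (⨁ T)) (toBounded.{w'} (T i)) :=
  let r : Retract (T i) (⨁ T) := ⟨biproduct.ι T i, biproduct.π T i, biproduct.ι_π_self T i⟩
  addClosure_of_retract (r.map (toBoundedFunctor C))

end BoundedDerived

section Biproduct

open Abelian

variable {C : Type u} [Category.{v} C] [Abelian C] [HasExt.{w} C]

lemma subsingleton_ext_biproduct {ι κ : Type} [Finite ι] [Finite κ] {X : ι → C} {Y : κ → C} {m : ℕ}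
    (h : ∀ i j, Subsingleton (Ext.{w} (X i) (Y j) m)) : Subsingleton (Ext.{w} (⨁ X) (⨁ Y) m) := by
  have := Fintype.ofFinite ι
  have := Fintype.ofFinite κ
  have (i : ι) : Subsingleton (Ext.{w} (X i) (⨁ Y) m) :=
    (Ext.addEquivBiproduct (X i) (biproduct.isBilimit Y) m).toEquiv.subsingleton
  exact (Ext.biproductAddEquiv (biproduct.isBilimit X) (⨁ Y) m).toEquiv.subsingleton

end Biproduct

end TiltingTheory

open TiltingTheory in
theorem mainTheorem5_general {k : Type*} [Field k] {B : Type u} [Category.{v} B] [Abelian B]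
    [Linear k B] [HasExt.{w} B] [HasDerivedCategory.{w'} B]
    (hKrull : HasFiniteKrullDimension B) {n : ℕ} (T : Fin n → B)
    (hhom : ∀ i X, Module.Finite k (T i ⟶ X))
    (hExt : ∀ i X, Module.Finite k (Abelian.Ext.{w} (T i) X 1))
    (hT : IsExceptionalCollection.{w} T) (hpd : ∀ i, HasProjectiveDimensionLE (T i) 1)
    (hext : ∀ i j, Subsingleton (Abelian.Ext.{w} (T i) (T j) 1))
    (hrank : Module.rank ℤ (K₀ B) ≤ n) : IsTiltingObject.{w'} (⨁ T) where
  hom_shift_eq_zero := by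
    refine toBounded_hom_shift_eq_zero.{w} fun m hm => subsingleton_ext_biproduct fun i j => ?_
    obtain rfl | hm : m = 1 ∨ 2 ≤ m := by omega
    · exact hext i j
    · exact subsingleton_of_forall_eq 0 fun x => x.eq_zero_of_hasProjectiveDimensionLT 2 hm
  generates P _ _ hTP := by
    have := hasTwoOutOfThree_toBounded P
    refine prop_of_prop_toBounded P (hT.prop_of_perpBelow k (Q := fun X => P (toBounded.{w'} X))
      (fun i => hTP _ (addClosure_toBounded_biproduct T i)) fun X hX => ?_)
    exact P.prop_of_isZero (isZero_toBounded (hT.isZero_of_perpBelow k hKrull hrank hX))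

theorem mainTheorem5 {k : Type*} [Field k] {B : Type u} [Category.{v} B] [Abelian B] [Linear k B]
    [HasExt.{w} B] [HasDerivedCategory.{w'} B]
    (hB : TiltingTheory.IsExtFinite.{w} k B)
    (hKrull : TiltingTheory.HasFiniteKrullDimension B)
    {n : ℕ} (T : Fin n → B)
    (hT : TiltingTheory.IsExceptionalCollection.{w} T)
    (hpd : ∀ i, HasProjectiveDimensionLE (T i) 1)
    (hext : ∀ i j, Subsingleton (Abelian.Ext.{w} (T i) (T j) 1))
    (hrank : Module.rank ℤ (TiltingTheory.K₀ B) = (n : Cardinal)) :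
    TiltingTheory.IsTiltingObject.{w'} (⨁ T) :=
  mainTheorem5_general hKrull T (fun _ _ => hB.finite_hom _ _)
    (fun _ _ => hB.finite_ext _ _ 1) hT hpd hext hrank.le
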